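/- Let $p$ be a prime, let $\Gamma$ be a topological group isomorphic to $\mathbb{Z}_p$ with topological generator $\gamma$, let $\Lambda=\mathbb{Z}_p[[\Gamma]]=\varprojlim_U\mathbb{Z}_p[\Gamma/U]$ be its Iwasawa algebra ($U$ running over the open normal subgroups of $\Gamma$), and put $T=\gamma-1\in\Lambda$, so that $\Lambda$ is identified with $\mathbb{Z}_p[[T]]$. Let $M$ be a discrete $p$-primary $\Lambda$-module which is cofinitely generated and cotorsion, i.e. whose Pontryagin dual $M^\vee=\mathrm{Hom}(M,\mathbb{Q}_p/\mathbb{Z}_p)$ is a finitely generated torsion $\Lambda$-module. By the structure theorem there is a homomorphism with finite kernel and cokernel \[M^\vee\longrightarrow \bigoplus_{i=1}^n\Lambda/(f_i(T))\ \oplus\ \bigoplus_{j=1}^m\Lambda/(p^{\mu_j})\] with distinguished polynomials $f_i(T)\in\mathbb{Z}_p[T]$ (monic, with all non-leading coefficients divisible by $p$) and integers $\mu_j\ge 0$. Put \[f_M(T)=p^{\sum_j\mu_j}\prod_i f_i(T),\qquad \mu_M=\sum_j\mu_j,\qquad \lambda_M=\deg f_M(T),\] and let $r_M$ be the order of vanishing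 of $f_M(T)$ at $T=0$. Let $\phi_M\colon M^\Gamma\to M_\Gamma$ be the map from the invariants to the coinvariants sending $x$ to its residue class, and assume that $\ker\phi_M$ and $\mathrm{coker}\,\phi_M$ are finite. Let \[\chi_t(\Gamma,M)=\frac{\#\ker\phi_M}{\#\mathrm{coker}\,\phi_M}\] be the truncated Euler characteristic. Then $\chi_t(\Gamma,M)=1$ if and only if $\mu_M=0$ and $\lambda_M=r_M$. -/

import Mathlib

open scoped Polynomial

noncomputable section

namespace TruncatedEuler

variable (p : ℕ) [Fact p.Prime]
variable (Γ : Type*) [CommGroup Γ] [TopologicalSpace Γ]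

/-- The product, over the open normal subgroups `U` of `Γ`, of the group rings `ℤ_p[Γ/U]`. -/
abbrev LevelProduct : Type _ :=
  (U : OpenNormalSubgroup Γ) → MonoidAlgebra ℤ_[p] (Γ ⧸ U.toSubgroup)

variable {Γ} in
/-- The transition map `ℤ_p[Γ/U] → ℤ_p[Γ/V]` for `U ≤ V`. -/
def transition {U V : OpenNormalSubgroup Γ} (h : U ≤ V) :
    MonoidAlgebra ℤ_[p] (Γ ⧸ U.toSubgroup) →ₐ[ℤ_[p]] MonoidAlgebra ℤ_[p] (Γ ⧸ V.toSubgroup) :=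
  MonoidAlgebra.mapDomainAlgHom ℤ_[p] ℤ_[p]
    (QuotientGroup.map U.toSubgroup V.toSubgroup (MonoidHom.id Γ) h)

/-- The compatible families in the product of the `ℤ_p[Γ/U]`. -/
def compatibleFamilies : Subalgebra ℤ_[p] (LevelProduct p Γ) where
  carrier := {x | ∀ (U V : OpenNormalSubgroup Γ) (h : U ≤ V), transition p h (x U) = x V}
  mul_mem' := fun ha hb U V h => by
    rw [Pi.mul_apply, map_mul, ha U V h, hb U V h, Pi.mul_apply]
  add_mem' := fun ha hb U V h => by
    rw [Pi.add_apply, map_add, ha U V h, hb U V h, Pi.add_apply]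
  algebraMap_mem' := fun r U V h => by
    rw [Pi.algebraMap_apply, AlgHom.commutes, Pi.algebraMap_apply]

/-- The Iwasawa algebra `ℤ_p[[Γ]]`, the inverse limit of the group rings `ℤ_p[Γ/U]`, realised as
the algebra of compatible families inside their product. -/
def IwasawaAlgebra : Type _ := compatibleFamilies p Γ

instance : CommRing (IwasawaAlgebra p Γ) :=
  inferInstanceAs (CommRing (compatibleFamilies p Γ))

instance : Algebra ℤ_[p] (IwasawaAlgebra p Γ) :=
  inferInstanceAs (Algebra ℤ_[p] (compatibleFamilies p Γ))

variable {Γ} in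
/-- The canonical homomorphism `Γ → ℤ_p[[Γ]]`, sending `g` to the family of its classes. -/
def groupElement : Γ →* IwasawaAlgebra p Γ where
  toFun g := ⟨fun U => MonoidAlgebra.of ℤ_[p] (Γ ⧸ U.toSubgroup) (QuotientGroup.mk g),
    fun U V h => by
      simp only [transition, MonoidAlgebra.of_apply, MonoidAlgebra.mapDomainAlgHom_apply,
        MonoidAlgebra.mapDomain_single]
      rfl⟩
  map_one' := Subtype.ext (funext fun U =>
    map_one (MonoidAlgebra.of ℤ_[p] (Γ ⧸ U.toSubgroup)))
  map_mul' g h := Subtype.ext (funext fun U =>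
    map_mul (MonoidAlgebra.of ℤ_[p] (Γ ⧸ U.toSubgroup)) (QuotientGroup.mk g) (QuotientGroup.mk h))

section GammaModule

variable (M : Type*) [AddCommGroup M] [Module (IwasawaAlgebra p Γ) M]

/-- The action of `Γ` on a `ℤ_p[[Γ]]`-module. -/
def gammaAction : Representation ℤ Γ M where
  toFun g :=
    { toFun := fun m => groupElement p g • m
      map_add' := fun a b => smul_add _ a b
      map_smul' := fun n a => smul_comm _ n a }
  map_one' := by
    ext m
    simp
  map_mul' g h := by
    ext m
    simp [mul_smul]

/-- `M` is a discrete `p`-primary `Γ`-module: every element is killed by a power of `p` and has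
an open stabiliser in `Γ`. -/
def IsDiscretePrimary : Prop :=
  (∀ m : M, ∃ n : ℕ, p ^ n • m = 0) ∧
    ∀ m : M, IsOpen {g : Γ | gammaAction p Γ M g m = m}

/-- The natural map `φ_M : M^Γ → M_Γ` sending `x` to its residue class. -/
def phi : (gammaAction p Γ M).invariants →ₗ[ℤ] (gammaAction p Γ M).Coinvariants :=
  Representation.Coinvariants.mk (gammaAction p Γ M) ∘ₗ (gammaAction p Γ M).invariants.subtype

/-- The kernel and the cokernel of `φ_M` are finite. -/
def HasFiniteTruncatedEulerChar : Prop :=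
  Finite (LinearMap.ker (phi p Γ M)) ∧
    Finite ((gammaAction p Γ M).Coinvariants ⧸ LinearMap.range (phi p Γ M))

/-- The truncated Euler characteristic `χ_t(Γ, M) = #ker φ_M / #coker φ_M`. -/
def truncatedEulerChar : ℚ :=
  (Nat.card (LinearMap.ker (phi p Γ M)) : ℚ) /
    Nat.card ((gammaAction p Γ M).Coinvariants ⧸ LinearMap.range (phi p Γ M))

/-- `M` is cofinitely generated: its Pontryagin dual `Hom(M, ℚ/ℤ)` (which for `p`-primary `M` is
`Hom(M, ℚ_p/ℤ_p)`) is a finitely generated `ℤ_p[[Γ]]`-module. -/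
def IsCofinitelyGenerated : Prop :=
  Module.Finite (IwasawaAlgebra p Γ) (CharacterModule M)

/-- `M` is cotorsion: its Pontryagin dual is a torsion `ℤ_p[[Γ]]`-module. -/
def IsCotorsion : Prop :=
  Module.IsTorsion (IwasawaAlgebra p Γ) (CharacterModule M)

end GammaModule

/-- The data of an elementary torsion module: distinguished polynomials `f_1, …, f_n` and
exponents `μ_1, …, μ_m`. -/
structure ElementaryData where
  n : ℕ
  f : Fin n → ℤ_[p][X]
  distinguished : ∀ i, (f i).IsDistinguishedAt (Ideal.span {(p : ℤ_[p])})
  m : ℕ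
  exponent : Fin m → ℕ

instance : Inhabited (ElementaryData p) :=
  ⟨⟨0, fun i => i.elim0, fun i => i.elim0, 0, fun i => i.elim0⟩⟩

namespace ElementaryData

variable {p} (D : ElementaryData p)

/-- The `μ`-invariant `∑ μ_j`. -/
def mu : ℕ := ∑ j, D.exponent j

/-- The characteristic polynomial `p ^ (∑ μ_j) * ∏ f_i`. -/
def charPoly : ℤ_[p][X] := Polynomial.C ((p : ℤ_[p]) ^ D.mu) * ∏ i, D.f i

variable {Γ}

/-- The elementary module `⨁ Λ/(f_i(T)) ⊕ ⨁ Λ/(p^μ_j)`, where `Λ = ℤ_p[[Γ]]` and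
`T = γ - 1`. -/
abbrev Carrier (γ : Γ) : Type _ :=
  ((i : Fin D.n) → IwasawaAlgebra p Γ ⧸
      Ideal.span {Polynomial.aeval (groupElement p γ - 1) (D.f i)}) ×
    ((j : Fin D.m) → IwasawaAlgebra p Γ ⧸
      Ideal.span {(p : IwasawaAlgebra p Γ) ^ D.exponent j})

end ElementaryData

section Invariants

variable {Γ} (γ : Γ)

/-- `X` is pseudo-isomorphic to the elementary module of `D`: there is a homomorphism between them
with finite kernel and finite cokernel. -/
def IsStructureOf (X : Type*) [AddCommGroup X] [Module (IwasawaAlgebra p Γ) X]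
    (D : ElementaryData p) : Prop :=
  ∃ ψ : X →ₗ[IwasawaAlgebra p Γ] D.Carrier γ,
    Finite (LinearMap.ker ψ) ∧ Finite (D.Carrier γ ⧸ LinearMap.range ψ)

variable (M : Type*) [AddCommGroup M] [Module (IwasawaAlgebra p Γ) M]

/-- The elementary module to which the Pontryagin dual of `M` is pseudo-isomorphic. It is provided
by the structure theorem when the dual is finitely generated and torsion; the invariants below do
not depend on the choice. -/
def structureData : ElementaryData p :=
  Classical.epsilon fun D => IsStructureOf p γ (CharacterModule M) D

/-- The characteristic polynomial `f_M(T)` of the Pontryagin dual of `M`. -/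
def charPoly : ℤ_[p][X] := (structureData p γ M).charPoly

/-- The `μ`-invariant `μ_M`. -/
def muInvariant : ℕ := (structureData p γ M).mu

/-- The `λ`-invariant `λ_M`, the degree of `f_M(T)`. -/
def lambdaInvariant : ℕ := (charPoly p γ M).natDegree

/-- `r_M`, the order of vanishing of `f_M(T)` at `T = 0`: `f_M(T) = T ^ r_M * g_M(T)` with
`g_M(0) ≠ 0`. -/
def rInvariant : ℕ := (charPoly p γ M).rootMultiplicity 0

end Invariants

end TruncatedEuler

end

noncomputable section

namespace TruncatedEuler

open PowerSeries

variable (p : ℕ) [Fact p.Prime]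

/-! Since `γ` generates a dense subgroup and stabilisers are open, `M^Γ = M[T]` and `M_Γ = M/TM`.
Hence `ker φ_M = M[T] ∩ TM` and `coker φ_M = M/(TM + M[T])`. Put `X = M^∨`. Duality over the
injective group `ℚ/ℤ` turns the two orders into the index of `TX + X[T]` in `X` and the order of
`X[T] ∩ TX`. These are exactly the orders of the cokernel and the kernel of `T` acting on `TX`, so
`χ_t = 1` says that this action has Herbrand quotient one.

The Herbrand quotient is unchanged by maps with finite kernel and cokernel, and a pseudo-isomorphism
`X → E` to the elementary module restricts to such a map `TX → TE`. On `TE` the cokernel of `T` is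
finite, which excludes `T² ∣ f_i`; therefore `T` is injective on `TE`. The quotient is then one iff
`T` is surjective on `TE`, which by Nakayama means `TE = 0`. This says that every `f_i` and every
`p^μ_j` divides `T`: all `μ_j` vanish and each `f_i` is `1` or `T`, which is `μ_M = 0` and `λ_M =
r_M` (`card_ker_eq_index_iff_of_pseudoIsomorphism`).

Two classical facts are proved along the way. The isomorphism `Λ ≅ ℤ_p⟦X⟧`
(`exists_algEquiv_powerSeries`) identifies each `ℤ_p[Γ/U]` with `ℤ_p⟦X⟧/((1+X)^(p^k) - 1)` and
passes to the limit by Krull's intersection theorem and compactness. The structure theorem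
(`exists_elementary_pseudoIsomorphism`) combines the decompositions over the principal ideal domains
`Λ[1/p]` and `Λ_(p)`: the errors are killed by a power of `p` and by a distinguished polynomial,
hence finite. -/

theorem finite_of_forall_smul_eq_zero {R N : Type*} [CommRing R] [AddCommGroup N] [Module R N]
    (I : Ideal R) [Finite (R ⧸ I)] [Module.Finite R N] (h : ∀ a ∈ I, ∀ n : N, a • n = 0) :
    Finite N := by
  have ht : Module.IsTorsionBySet R N I := fun n a => h a a.2 n
  let _ := ht.module
  have : IsScalarTower R (R ⧸ I) N := ht.isScalarTower
  have : Module.Finite (R ⧸ I) N := Module.Finite.of_restrictScalars_finite R (R ⧸ I) N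
  exact Module.finite_of_finite (R ⧸ I)

/-! ### Weierstrass theory in `ℤ_p⟦X⟧`. -/

theorem finite_padicInt_quotient (k : ℕ) : Finite (ℤ_[p] ⧸ Ideal.span {(p : ℤ_[p]) ^ k}) := by
  rw [← PadicInt.ker_toZModPow]
  exact Finite.of_equiv _ (RingHom.quotientKerEquivOfSurjective
    (ZMod.ringHom_surjective (PadicInt.toZModPow (p := p) k))).symm.toEquiv

theorem powerSeries_dvd_of_map_eq_zero {b : ℤ_[p]⟦X⟧}
    (hb : b.map (IsLocalRing.residue ℤ_[p]) = 0) : (p : ℤ_[p]⟦X⟧) ∣ b := by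
  have h : ∀ n, ∃ c, coeff n b = p * c := fun n => by
    have := congrArg (coeff n) hb
    rw [coeff_map, map_zero, IsLocalRing.residue_eq_zero_iff, PadicInt.maximalIdeal_eq_span_p,
      Ideal.mem_span_singleton] at this
    exact this
  choose c hc using h
  refine ⟨PowerSeries.mk c, PowerSeries.ext fun n => ?_⟩
  rw [hc, ← map_natCast (C (R := ℤ_[p])) p, coeff_C_mul, coeff_mk]

/-- The multiples of `p` are the kernel of reduction to power series over the residue field, and
these form a domain. -/
theorem powerSeries_natCast_prime : Prime (p : ℤ_[p]⟦X⟧) := by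
  have hker : ∀ b : ℤ_[p]⟦X⟧, (p : ℤ_[p]⟦X⟧) ∣ b ↔ b.map (IsLocalRing.residue ℤ_[p]) = 0 := by
    refine fun b => ⟨?_, powerSeries_dvd_of_map_eq_zero p⟩
    rintro ⟨c, rfl⟩
    have : IsLocalRing.residue ℤ_[p] p = 0 := by
      rw [IsLocalRing.residue_eq_zero_iff, PadicInt.maximalIdeal_eq_span_p]
      exact Ideal.mem_span_singleton_self _
    rw [map_mul, ← map_natCast (C (R := ℤ_[p])) p, map_C, this, map_zero, zero_mul]
  refine ⟨fun h => ?_, fun h => ?_, fun a b h => ?_⟩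
  · have := congrArg (coeff 0) h
    rw [← map_natCast (C (R := ℤ_[p])) p, coeff_zero_C, map_zero] at this
    exact NeZero.ne p (Nat.cast_eq_zero.mp this)
  · have := (hker 1).mp (isUnit_iff_dvd_one.mp h)
    simp at this
  · simpa only [hker, map_mul, mul_eq_zero] using h

/-- Weierstrass preparation after removing the exact power of `p`. The degree of `f` is the order of
`a / p^k` modulo `p`, whence the nonvanishing coefficient; when `a` is a polynomial it gives `deg f
≤ deg a`. -/
theorem powerSeries_exists_factorization {a : ℤ_[p]⟦X⟧} (ha : a ≠ 0) :
    ∃ (k : ℕ) (u : ℤ_[p]⟦X⟧) (f : ℤ_[p][X]), IsUnit u ∧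
      f.IsDistinguishedAt (Ideal.span {(p : ℤ_[p])}) ∧ a = p ^ k * (u * f) ∧
      coeff f.natDegree a ≠ 0 := by
  have hfin : FiniteMultiplicity (p : ℤ_[p]⟦X⟧) a :=
    FiniteMultiplicity.of_not_isUnit (powerSeries_natCast_prime p).not_isUnit ha
  obtain ⟨b, hab, hb⟩ := hfin.exists_eq_pow_mul_and_not_dvd
  have hb' : b.map (IsLocalRing.residue ℤ_[p]) ≠ 0 := fun h =>
    hb (powerSeries_dvd_of_map_eq_zero p h)
  obtain ⟨f, u, H⟩ := exists_isWeierstrassFactorization hb'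
  refine ⟨multiplicity (p : ℤ_[p]⟦X⟧) a, u, f, H.isUnit,
    by simpa only [PadicInt.maximalIdeal_eq_span_p] using H.isDistinguishedAt, ?_, ?_⟩
  · rw [mul_comm u, ← H.eq_mul, ← hab]
  · have h1 := H.natDegree_eq_toNat_order_map
    have h2 := coeff_order hb'
    rw [← h1, coeff_map] at h2
    rw [hab, ← map_natCast (C (R := ℤ_[p])) p, ← map_pow, coeff_C_mul]
    refine mul_ne_zero (pow_ne_zero _ (Nat.cast_ne_zero.mpr (NeZero.ne p))) fun h => ?_
    simp [h] at h2

theorem powerSeries_exists_division {f : ℤ_[p][X]}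
    (hf : f.IsDistinguishedAt (Ideal.span {(p : ℤ_[p])})) (a : ℤ_[p]⟦X⟧) :
    ∃ (q : ℤ_[p]⟦X⟧) (r : ℤ_[p][X]), a = f * q + r ∧ r.degree < f.degree := by
  rw [← PadicInt.maximalIdeal_eq_span_p] at hf
  have hne : IsLocalRing.maximalIdeal ℤ_[p] ≠ ⊤ := Ideal.IsPrime.ne_top'
  have H := (hf.isWeierstrassDivisorAt hne).isWeierstrassDivisionAt_div_mod a
  refine ⟨_, _, H.eq_mul_add, H.degree_lt.trans_le ?_⟩
  rw [Polynomial.degree_eq_natDegree hf.monic.ne_zero]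
  -- The remainder is bounded by the order of `f` modulo `p`, which for a distinguished polynomial
  -- is its degree.
  have := congrArg ENat.toNat (hf.coe_natDegree_eq_order_map (f : ℤ_[p]⟦X⟧) 1
    (by rwa [map_one, ← Ideal.ne_top_iff_one]) (by simp))
  rw [← this]
  simp

/-- Modulo `f`, power series reduce to polynomials modulo a monic one, a finite `ℤ_p`-module; being
killed by `p^k` as well makes it a finite set. -/
theorem powerSeries_finite_quotient {f : ℤ_[p][X]}
    (hf : f.IsDistinguishedAt (Ideal.span {(p : ℤ_[p])})) (k : ℕ) :
    Finite (ℤ_[p]⟦X⟧ ⧸ Ideal.span {(p : ℤ_[p]⟦X⟧) ^ k, (f : ℤ_[p]⟦X⟧)}) := by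
  have := finite_padicInt_quotient p k
  have h1 : Module.Finite ℤ_[p] (ℤ_[p][X] ⧸ Ideal.span {f}) := hf.monic.finite_quotient
  rw [← PadicInt.maximalIdeal_eq_span_p] at hf
  have h2 : Module.Finite ℤ_[p] (ℤ_[p]⟦X⟧ ⧸ Ideal.span {(f : ℤ_[p]⟦X⟧)}) :=
    Module.Finite.equiv hf.algEquivQuotient.toLinearEquiv
  have hle : Ideal.span {(f : ℤ_[p]⟦X⟧)} ≤ Ideal.span {(p : ℤ_[p]⟦X⟧) ^ k, (f : ℤ_[p]⟦X⟧)} :=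
    Ideal.span_mono (by simp)
  have h3 : Module.Finite ℤ_[p] (ℤ_[p]⟦X⟧ ⧸ Ideal.span {(p : ℤ_[p]⟦X⟧) ^ k, (f : ℤ_[p]⟦X⟧)}) :=
    Module.Finite.of_surjective (Ideal.Quotient.factorₐ ℤ_[p] hle).toLinearMap
      (Ideal.Quotient.factor_surjective hle)
  refine finite_of_forall_smul_eq_zero (R := ℤ_[p]) (Ideal.span {(p : ℤ_[p]) ^ k}) fun a ha n => ?_
  obtain ⟨c, rfl⟩ := Ideal.mem_span_singleton.mp ha
  obtain ⟨n, rfl⟩ := Ideal.Quotient.mk_surjective n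
  rw [← Ideal.Quotient.mkₐ_eq_mk ℤ_[p], ← map_smul, Ideal.Quotient.mkₐ_eq_mk,
    Ideal.Quotient.eq_zero_iff_mem, mul_smul, Algebra.smul_def, map_pow, map_natCast]
  exact Ideal.mul_mem_right _ _ (Ideal.subset_span (by simp))

/-! ### Weierstrass theory in an algebra isomorphic to `ℤ_p⟦X⟧`. -/

section Transport

variable {p}

theorem natCast_prime_of_algEquiv {A : Type*} [CommRing A] [Algebra ℤ_[p] A]
    (e : A ≃ₐ[ℤ_[p]] ℤ_[p]⟦X⟧) : Prime (p : A) := by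
  have := powerSeries_natCast_prime p
  rw [← MulEquiv.prime_iff (e : A ≃* ℤ_[p]⟦X⟧)]
  rwa [← map_natCast e p] at this

variable {A : Type*} [CommRing A] [Algebra ℤ_[p] A] (e : A ≃ₐ[ℤ_[p]] ℤ_[p]⟦X⟧) {T : A}
  (hT : e T = PowerSeries.X)
include hT

theorem apply_aeval (f : ℤ_[p][X]) : e (Polynomial.aeval T f) = (f : ℤ_[p]⟦X⟧) := by
  have := Polynomial.aeval_algHom_apply (e : A →ₐ[ℤ_[p]] ℤ_[p]⟦X⟧) T f
  change Polynomial.aeval (e T) f = e (Polynomial.aeval T f) at this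
  rw [← this, hT, ← Polynomial.coe_X]
  have h2 := Polynomial.aeval_algHom_apply (Polynomial.coeToPowerSeries.algHom (R := ℤ_[p]) ℤ_[p])
    Polynomial.X f
  simpa using h2

theorem aeval_eq_zero_iff {f : ℤ_[p][X]} : Polynomial.aeval T f = 0 ↔ f = 0 := by
  rw [← map_eq_zero_iff e e.injective, apply_aeval e hT]
  exact_mod_cast Iff.rfl

theorem exists_factorization {a : A} (ha : a ≠ 0) :
    ∃ (k : ℕ) (u : A) (f : ℤ_[p][X]), IsUnit u ∧
      f.IsDistinguishedAt (Ideal.span {(p : ℤ_[p])}) ∧ a = p ^ k * (u * Polynomial.aeval T f) ∧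
      coeff f.natDegree (e a) ≠ 0 := by
  obtain ⟨k, u, f, hu, hf, h, hc⟩ := powerSeries_exists_factorization p
    ((map_ne_zero_iff e e.injective).mpr ha)
  refine ⟨k, e.symm u, f, hu.map e.symm, hf, e.injective ?_, hc⟩
  simpa [apply_aeval e hT] using h

theorem exists_division {f : ℤ_[p][X]}
    (hf : f.IsDistinguishedAt (Ideal.span {(p : ℤ_[p])})) (a : A) :
    ∃ (q : A) (r : ℤ_[p][X]),
      a = Polynomial.aeval T f * q + Polynomial.aeval T r ∧ r.degree < f.degree := by
  obtain ⟨q, r, h, hr⟩ := powerSeries_exists_division p hf (e a)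
  refine ⟨e.symm q, r, e.injective ?_, hr⟩
  simpa [apply_aeval e hT] using h

theorem finite_quotient_of_distinguished {f : ℤ_[p][X]}
    (hf : f.IsDistinguishedAt (Ideal.span {(p : ℤ_[p])})) (k : ℕ) :
    Finite (A ⧸ Ideal.span {(p : A) ^ k, Polynomial.aeval T f}) := by
  have := powerSeries_finite_quotient p hf k
  refine Finite.of_equiv _ (Ideal.quotientEquiv (Ideal.span {(p : A) ^ k, Polynomial.aeval T f})
    (Ideal.span {(p : ℤ_[p]⟦X⟧) ^ k, (f : ℤ_[p]⟦X⟧)}) (e : A ≃+* ℤ_[p]⟦X⟧) ?_).symm.toEquiv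
  rw [Ideal.map_span]
  simp [Set.image_pair, apply_aeval e hT]

/-- A finitely generated module killed by a power of `p` and by a distinguished polynomial in `T`
is finite. -/
theorem finite_of_pow_smul_of_aeval_smul {N : Type*} [AddCommGroup N] [Module A N]
    [Module.Finite A N] {f : ℤ_[p][X]} (hf : f.IsDistinguishedAt (Ideal.span {(p : ℤ_[p])}))
    {k : ℕ} (h1 : ∀ n : N, (p : A) ^ k • n = 0) (h2 : ∀ n : N, Polynomial.aeval T f • n = 0) :
    Finite N := by
  have := finite_quotient_of_distinguished e hT hf k
  refine finite_of_forall_smul_eq_zero (Ideal.span {(p : A) ^ k, Polynomial.aeval T f})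
    fun a ha n => ?_
  obtain ⟨x, y, rfl⟩ := Ideal.mem_span_pair.mp ha
  rw [add_smul, mul_smul, mul_smul, h1, h2, smul_zero, smul_zero, add_zero]

end Transport

/-! ### Group rings of cyclic `p`-groups as quotients of `ℤ_p⟦X⟧`. -/

section EvalGroupRing

variable {p : ℕ} [Fact p.Prime]

theorem monic_X_add_one_pow_sub_one {q : ℕ} (hq : 0 < q) :
    ((Polynomial.X + 1 : ℤ_[p][X]) ^ q - 1).Monic ∧
      ((Polynomial.X + 1 : ℤ_[p][X]) ^ q - 1).natDegree = q := by
  have hX : (Polynomial.X + 1 : ℤ_[p][X]) = Polynomial.X + Polynomial.C 1 := by simp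
  have hdeg : ((Polynomial.X + 1 : ℤ_[p][X]) ^ q).natDegree = q := by
    rw [hX, Polynomial.natDegree_pow_X_add_C]
  have hmon : ((Polynomial.X + 1 : ℤ_[p][X]) ^ q).Monic := by
    rw [hX]; exact (Polynomial.monic_X_add_C 1).pow _
  refine ⟨hmon.sub_of_left ?_, ?_⟩
  · rw [Polynomial.degree_one, Polynomial.degree_eq_natDegree hmon.ne_zero, hdeg]
    exact_mod_cast hq
  · rw [Polynomial.natDegree_sub_eq_left_of_natDegree_lt (by rw [hdeg]; simpa using hq), hdeg]

theorem isDistinguishedAt_X_add_one_pow_sub_one (k : ℕ) :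
    ((Polynomial.X + 1 : ℤ_[p][X]) ^ p ^ k - 1).IsDistinguishedAt
      (Ideal.span {(p : ℤ_[p])}) := by
  obtain ⟨hmon, hdeg⟩ := monic_X_add_one_pow_sub_one (p := p)
    (pow_pos (Nat.Prime.pos (Fact.out : p.Prime)) k)
  refine { mem := fun {n} hn => ?_, monic := hmon }
  rw [hdeg] at hn
  rw [Polynomial.coeff_sub, Polynomial.coeff_X_add_one_pow, Polynomial.coeff_one]
  rcases Nat.eq_zero_or_pos n with rfl | h0
  · simp
  · rw [if_neg h0.ne', sub_zero, Ideal.mem_span_singleton]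
    exact Nat.cast_dvd_cast (Nat.Prime.dvd_choose_pow Fact.out h0.ne' hn.ne)

variable {G : Type*} [CommGroup G] {g : G}

theorem eq_zero_of_aeval_of_eq_zero {s : ℤ_[p][X]} (hs : s.degree < orderOf g)
    (h : Polynomial.aeval (MonoidAlgebra.of ℤ_[p] G g) s = 0) : s = 0 := by
  ext j
  rw [Polynomial.coeff_zero]
  rcases lt_or_ge j (orderOf g) with hj | hj
  · rcases eq_or_ne s 0 with rfl | hs0
    · simp
    have hs' : s.natDegree < orderOf g := (Polynomial.natDegree_lt_iff_degree_lt hs0).mpr hs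
    rw [Polynomial.aeval_eq_sum_range' hs'] at h
    have h2 := congrArg (fun x => x.coeff (g ^ j)) h
    simp only [MonoidAlgebra.of_apply, MonoidAlgebra.coeff_sum, MonoidAlgebra.single_pow, one_pow,
      MonoidAlgebra.coeff_smul, MonoidAlgebra.coeff_single, Finsupp.finsetSum_apply,
      Finsupp.smul_apply, MonoidAlgebra.coeff_zero, Finsupp.zero_apply] at h2
    rw [Finset.sum_eq_single j] at h2
    · simpa using h2
    · intro i hi hij
      rw [Finsupp.single_eq_of_ne, smul_zero]
      intro hgij
      exact hij (pow_injOn_Iio_orderOf (Finset.mem_range.mp hi) hj hgij.symm)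
    · intro hjn
      exact absurd (Finset.mem_range.mpr hj) hjn
  · exact Polynomial.coeff_eq_zero_of_degree_lt (hs.trans_le (by exact_mod_cast hj))

theorem aeval_of_sub_one_surjective (hg : ∀ x : G, x ∈ Submonoid.powers g) :
    Function.Surjective (Polynomial.aeval (R := ℤ_[p]) (MonoidAlgebra.of ℤ_[p] G g - 1)) := by
  intro x
  induction x using MonoidAlgebra.induction_on with
  | of x =>
    obtain ⟨n, rfl⟩ := hg x
    exact ⟨(Polynomial.X + 1) ^ n, by simp⟩
  | add a b ha hb =>
    obtain ⟨a, rfl⟩ := ha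
    obtain ⟨b, rfl⟩ := hb
    exact ⟨a + b, map_add _ _ _⟩
  | smul r a ha =>
    obtain ⟨a, rfl⟩ := ha
    exact ⟨r • a, map_smul _ _ _⟩

/-- After division by `ω`, substituting `X - 1` turns the remainder into a polynomial in `g` of
degree below the order of `g`; the powers of `g` in that range are linearly independent. -/
theorem aeval_of_sub_one_eq_zero_iff {k : ℕ} (hk : orderOf g = p ^ k) (f : ℤ_[p][X]) :
    Polynomial.aeval (MonoidAlgebra.of ℤ_[p] G g - 1) f = 0 ↔
      ((Polynomial.X + 1 : ℤ_[p][X]) ^ p ^ k - 1) ∣ f := by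
  set ω : ℤ_[p][X] := (Polynomial.X + 1 : ℤ_[p][X]) ^ p ^ k - 1 with hω
  have hd := isDistinguishedAt_X_add_one_pow_sub_one (p := p) k
  have hz : Polynomial.aeval (MonoidAlgebra.of ℤ_[p] G g - 1) ω = 0 := by
    simp only [hω, map_sub, map_pow, map_add, Polynomial.aeval_X, map_one, sub_add_cancel]
    rw [← map_pow, ← hk, pow_orderOf_eq_one, map_one, sub_self]
  refine ⟨fun h => ?_, fun ⟨c, hc⟩ => by rw [hc, map_mul, hz, zero_mul]⟩
  rw [← Polynomial.modByMonic_eq_zero_iff_dvd hd.monic]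
  have hr : Polynomial.aeval (MonoidAlgebra.of ℤ_[p] G g - 1) (f %ₘ ω) = 0 := by
    rw [← Polynomial.modByMonic_add_div f ω, map_add, map_mul, hz, zero_mul, add_zero] at h
    exact h
  have hdeg : ω.natDegree = orderOf g :=
    hk ▸ (monic_X_add_one_pow_sub_one (pow_pos (Nat.Prime.pos Fact.out) k)).2
  have hlt : ((f %ₘ ω).comp (Polynomial.X - 1)).degree < orderOf g := by
    have h1 := Polynomial.degree_modByMonic_lt f hd.monic
    rw [Polynomial.degree_eq_natDegree hd.monic.ne_zero, hdeg] at h1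
    have hX : (Polynomial.X - 1 : ℤ_[p][X]) = Polynomial.X - Polynomial.C 1 := by simp
    refine lt_of_le_of_lt ?_ h1
    rcases eq_or_ne (f %ₘ ω) 0 with h0 | h0
    · simp [h0]
    rw [Polynomial.degree_eq_natDegree h0]
    refine Polynomial.degree_le_of_natDegree_le ?_
    rw [Polynomial.natDegree_comp, hX, Polynomial.natDegree_X_sub_C, mul_one]
  have hs := eq_zero_of_aeval_of_eq_zero (p := p) (g := g) (s := (f %ₘ ω).comp (Polynomial.X - 1))
    hlt (by simpa [Polynomial.aeval_comp] using hr)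
  have := congrArg (fun q => q.comp (Polynomial.X + 1)) hs
  simpa [Polynomial.comp_assoc] using this

/-- Evaluating a power series at `g - 1` needs no topology on the group ring: `ω` is distinguished,
so `ℤ_p⟦X⟧/(ω)` is already `ℤ_p[X]/(ω)`. -/
theorem exists_algHom_groupRing {k : ℕ} (hk : orderOf g = p ^ k)
    (hg : ∀ x : G, x ∈ Submonoid.powers g) :
    ∃ φ : ℤ_[p]⟦X⟧ →ₐ[ℤ_[p]] MonoidAlgebra ℤ_[p] G,
      (∀ f : ℤ_[p][X], φ f = Polynomial.aeval (MonoidAlgebra.of ℤ_[p] G g - 1) f) ∧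
      Function.Surjective φ ∧
      ∀ a, φ a = 0 ↔ (((Polynomial.X + 1 : ℤ_[p][X]) ^ p ^ k - 1 : ℤ_[p][X]) : ℤ_[p]⟦X⟧) ∣ a := by
  have hd := isDistinguishedAt_X_add_one_pow_sub_one (p := p) k
  have hz := aeval_of_sub_one_eq_zero_iff (p := p) (g := g) hk
  set ω : ℤ_[p][X] := (Polynomial.X + 1 : ℤ_[p][X]) ^ p ^ k - 1 with hω
  rw [← PadicInt.maximalIdeal_eq_span_p] at hd
  let ψ : (ℤ_[p][X] ⧸ Ideal.span {ω}) →ₐ[ℤ_[p]] MonoidAlgebra ℤ_[p] G :=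
    Ideal.Quotient.liftₐ (Ideal.span {ω}) (Polynomial.aeval (MonoidAlgebra.of ℤ_[p] G g - 1))
      fun a ha => (hz a).mpr (Ideal.mem_span_singleton.mp ha)
  let φ := (ψ.comp (hd.algEquivQuotient.symm : _ →ₐ[ℤ_[p]] _)).comp
    (Ideal.Quotient.mkₐ ℤ_[p] (Ideal.span {(ω : ℤ_[p]⟦X⟧)}))
  have hφ : ∀ f : ℤ_[p][X], φ f = Polynomial.aeval (MonoidAlgebra.of ℤ_[p] G g - 1) f := by
    intro f
    have : hd.algEquivQuotient.symm (Ideal.Quotient.mk _ (f : ℤ_[p]⟦X⟧)) =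
        Ideal.Quotient.mk _ f := by
      rw [AlgEquiv.symm_apply_eq]
      rfl
    change ψ (hd.algEquivQuotient.symm (Ideal.Quotient.mk _ (f : ℤ_[p]⟦X⟧))) = _
    rw [this]
    rfl
  have hinj : Function.Injective ψ := by
    rw [injective_iff_map_eq_zero]
    intro a ha
    obtain ⟨a, rfl⟩ := Ideal.Quotient.mk_surjective a
    exact Ideal.Quotient.eq_zero_iff_mem.mpr (Ideal.mem_span_singleton.mpr ((hz a).mp ha))
  refine ⟨φ, hφ, fun x => ?_, fun a => ?_⟩
  · obtain ⟨f, rfl⟩ := aeval_of_sub_one_surjective hg x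
    exact ⟨f, hφ f⟩
  · change ψ (hd.algEquivQuotient.symm (Ideal.Quotient.mk _ a)) = 0 ↔ _
    rw [map_eq_zero_iff ψ hinj, EmbeddingLike.map_eq_zero_iff, Ideal.Quotient.eq_zero_iff_mem,
      Ideal.mem_span_singleton]

/-- A substitute for continuity: Weierstrass division by a distinguished polynomial in the kernel
reduces every power series to its polynomial remainder. -/
theorem algHom_ext_of_eq_on_polynomial {B : Type*} [CommRing B] [Algebra ℤ_[p] B]
    {φ ψ : ℤ_[p]⟦X⟧ →ₐ[ℤ_[p]] B} (h : ∀ f : ℤ_[p][X], φ f = ψ f) {ω : ℤ_[p][X]}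
    (hω : ω.IsDistinguishedAt (Ideal.span {(p : ℤ_[p])})) (h0 : φ ω = 0) : φ = ψ := by
  ext a
  obtain ⟨q, r, rfl, -⟩ := powerSeries_exists_division p hω a
  rw [map_add, map_add, map_mul, map_mul, ← h ω, h0, zero_mul, zero_mul, h r]

end EvalGroupRing

/-! ### Finite quotients of `Γ`. -/

section Gamma

variable {p : ℕ} [Fact p.Prime] {Γ : Type*} [CommGroup Γ] [TopologicalSpace Γ]
  [IsTopologicalGroup Γ] (E : Γ ≃ₜ* Multiplicative ℤ_[p])
  {γ : Γ} (hγ : (Subgroup.zpowers γ).topologicalClosure = ⊤)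

omit [IsTopologicalGroup Γ] in
include E in
theorem tendsto_pow_pow_nhds_one (g : Γ) :
    Filter.Tendsto (fun n : ℕ => g ^ p ^ n) Filter.atTop (nhds 1) := by
  have h : Filter.Tendsto (fun n : ℕ => (p : ℤ_[p]) ^ n * (E g).toAdd) Filter.atTop (nhds 0) := by
    rw [← zero_mul (E g).toAdd]
    exact (tendsto_pow_atTop_nhds_zero_of_norm_lt_one (PadicInt.norm_p (p := p) ▸ inv_lt_one_of_one_lt₀
      (by exact_mod_cast Nat.Prime.one_lt Fact.out))).mul_const _
  have h2 : Filter.Tendsto (fun n : ℕ => E.symm (Multiplicative.ofAdd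
      ((p : ℤ_[p]) ^ n * (E g).toAdd))) Filter.atTop (nhds (E.symm (Multiplicative.ofAdd 0))) :=
    ((E.symm.continuous.comp continuous_ofAdd).tendsto 0).comp h
  rw [ofAdd_zero, map_one] at h2
  refine h2.congr fun n => ?_
  rw [ContinuousMulEquiv.symm_apply_eq, map_pow]
  apply Multiplicative.toAdd.injective
  simp

include hγ in
theorem mem_zpowers_mk (U : OpenNormalSubgroup Γ) (x : Γ ⧸ U.toSubgroup) :
    x ∈ Subgroup.zpowers (QuotientGroup.mk γ : Γ ⧸ U.toSubgroup) := by
  obtain ⟨x, rfl⟩ := QuotientGroup.mk_surjective x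
  have hd : Dense (Subgroup.zpowers γ : Set Γ) := by
    intro y
    rw [← Subgroup.topologicalClosure_coe, hγ]
    trivial
  have hopen : IsOpen ((fun y => x⁻¹ * y) ⁻¹' (U : Set Γ)) :=
    U.isOpen'.preimage (continuous_const_mul x⁻¹)
  obtain ⟨y, hy, n, rfl⟩ := hd.inter_open_nonempty _ hopen ⟨x, by simp⟩
  refine ⟨n, ?_⟩
  change (QuotientGroup.mk γ : Γ ⧸ U.toSubgroup) ^ n = QuotientGroup.mk x
  rw [← QuotientGroup.mk_zpow]
  exact (QuotientGroup.eq.mpr hy).symm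

omit [IsTopologicalGroup Γ] in
include E in
theorem exists_orderOf_mk_eq_pow (g : Γ) (U : OpenNormalSubgroup Γ) :
    ∃ k, orderOf (QuotientGroup.mk g : Γ ⧸ U.toSubgroup) = p ^ k := by
  have hU : (U : Set Γ) ∈ nhds (1 : Γ) := U.isOpen'.mem_nhds U.one_mem
  obtain ⟨n, hn⟩ := ((tendsto_pow_pow_nhds_one E g).eventually_mem hU).exists
  have : orderOf (QuotientGroup.mk g : Γ ⧸ U.toSubgroup) ∣ p ^ n := by
    apply orderOf_dvd_of_pow_eq_one
    rw [← QuotientGroup.mk_pow]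
    exact (QuotientGroup.eq_one_iff _).mpr hn
  obtain ⟨k, -, hk⟩ := (Nat.dvd_prime_pow Fact.out).mp this
  exact ⟨k, hk⟩

include E hγ in
theorem mem_powers_mk (U : OpenNormalSubgroup Γ) (x : Γ ⧸ U.toSubgroup) :
    x ∈ Submonoid.powers (QuotientGroup.mk γ : Γ ⧸ U.toSubgroup) := by
  obtain ⟨k, hk⟩ := exists_orderOf_mk_eq_pow E γ U
  have hfin : IsOfFinOrder (QuotientGroup.mk γ : Γ ⧸ U.toSubgroup) :=
    orderOf_pos_iff.mp (hk ▸ pow_pos (Nat.Prime.pos Fact.out) k)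
  exact hfin.mem_powers_iff_mem_zpowers.mpr (mem_zpowers_mk hγ U x)

/-- The open subgroup of `Γ` corresponding to `p ^ n ℤ_p`. -/
def levelSubgroup (n : ℕ) : OpenNormalSubgroup Γ where
  toSubgroup := (AddSubgroup.toSubgroup
    (Ideal.span {(p : ℤ_[p]) ^ n}).toAddSubgroup).comap (E : Γ →* Multiplicative ℤ_[p])
  isOpen' := by
    have h : IsOpen (Multiplicative.toAdd ⁻¹' (Metric.closedBall (0 : ℤ_[p]) ((p : ℝ) ^ (-n : ℤ)))) :=
      (IsUltrametricDist.isOpen_closedBall 0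
        (zpow_pos (by exact_mod_cast Nat.Prime.pos Fact.out) _).ne').preimage continuous_toAdd
    convert h.preimage E.continuous using 1
    ext x
    rw [Set.mem_preimage, Set.mem_preimage, mem_closedBall_zero_iff,
      PadicInt.norm_le_pow_iff_mem_span_pow]
    rfl

omit [IsTopologicalGroup Γ] in
theorem mem_levelSubgroup {n : ℕ} {x : Γ} :
    x ∈ (levelSubgroup E n).toSubgroup ↔ (p : ℤ_[p]) ^ n ∣ (E x).toAdd :=
  Ideal.mem_span_singleton

include E hγ in
-- If `γ` had order `p^k` with `k < n` modulo `p^n ℤ_p`, its image in `ℤ_p` would be divisible by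
-- `p`, and its powers could not be dense modulo `p`.
theorem exists_le_orderOf_mk (n : ℕ) : ∃ (U : OpenNormalSubgroup Γ) (k : ℕ), n ≤ k ∧
    orderOf (QuotientGroup.mk γ : Γ ⧸ U.toSubgroup) = p ^ k := by
  obtain ⟨k, hk⟩ := exists_orderOf_mk_eq_pow E γ (levelSubgroup E n)
  refine ⟨levelSubgroup E n, k, ?_, hk⟩
  by_contra! hlt
  have h1 : γ ^ p ^ k ∈ (levelSubgroup E n).toSubgroup := by
    rw [← QuotientGroup.eq_one_iff, QuotientGroup.mk_pow, ← hk, pow_orderOf_eq_one]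
  rw [mem_levelSubgroup, map_pow, toAdd_pow, nsmul_eq_mul, Nat.cast_pow] at h1
  have h2 : (p : ℤ_[p]) ^ 1 ∣ (E γ).toAdd := by
    have : (p : ℤ_[p]) ^ (k + 1) ∣ (p : ℤ_[p]) ^ k * (E γ).toAdd :=
      (pow_dvd_pow _ hlt).trans h1
    rw [pow_succ] at this
    rw [pow_one]
    exact (mul_dvd_mul_iff_left (pow_ne_zero _ (Nat.cast_ne_zero.mpr (NeZero.ne p)))).mp this
  have h3 : ∀ x : Γ, x ∈ (levelSubgroup E 1).toSubgroup := fun x => by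
    obtain ⟨m, hm⟩ := mem_zpowers_mk hγ (levelSubgroup E 1) (QuotientGroup.mk x)
    rw [← QuotientGroup.eq_one_iff, ← hm]
    change (QuotientGroup.mk γ : Γ ⧸ (levelSubgroup E 1).toSubgroup) ^ m = 1
    rw [(QuotientGroup.eq_one_iff γ).mpr ((mem_levelSubgroup E).mpr h2), one_zpow]
  have h4 := (mem_levelSubgroup E).mp (h3 (E.symm (Multiplicative.ofAdd 1)))
  rw [E.apply_symm_apply, toAdd_ofAdd, pow_one] at h4
  exact PadicInt.prime_p.not_isUnit (isUnit_of_dvd_one h4)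

end Gamma

/-! ### Krull intersection for the polynomials `(1+X)^(p^k) - 1`. -/

section KrullIntersection

variable {p : ℕ} [Fact p.Prime]

theorem natCast_mem_maximalIdeal : (p : ℤ_[p]⟦X⟧) ∈ IsLocalRing.maximalIdeal ℤ_[p]⟦X⟧ :=
  (IsLocalRing.mem_maximalIdeal _).mpr (powerSeries_natCast_prime p).not_isUnit

/-- Passing from `k` to `k + 1` replaces `y` by `(1 + y)^p - 1 = p y + z y²`, and both terms gain a
factor in the maximal ideal. -/
theorem X_add_one_pow_sub_one_mem (k : ℕ) :
    (X + 1 : ℤ_[p]⟦X⟧) ^ p ^ k - 1 ∈ IsLocalRing.maximalIdeal ℤ_[p]⟦X⟧ ^ (k + 1) := by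
  induction k with
  | zero =>
    suffices (X : ℤ_[p]⟦X⟧) ∈ IsLocalRing.maximalIdeal ℤ_[p]⟦X⟧ by simpa using this
    exact (IsLocalRing.mem_maximalIdeal _).mpr X_prime.not_isUnit
  | succ k ih =>
    set y := (X + 1 : ℤ_[p]⟦X⟧) ^ p ^ k - 1 with hy
    obtain ⟨z, hz⟩ := Polynomial.powAddExpansion (1 : ℤ_[p]⟦X⟧) y p
    have h : (X + 1 : ℤ_[p]⟦X⟧) ^ p ^ (k + 1) - 1 = p * y + z * y ^ 2 := by
      rw [pow_succ, pow_mul, show (X + 1 : ℤ_[p]⟦X⟧) ^ p ^ k = 1 + y by rw [hy]; ring, hz]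
      ring
    rw [h, pow_succ _ (k + 1)]
    refine add_mem ?_ ?_
    · rw [mul_comm (p : ℤ_[p]⟦X⟧)]
      exact Ideal.mul_mem_mul ih natCast_mem_maximalIdeal
    · rw [pow_two]
      exact Ideal.mul_mem_left _ z
        (Ideal.mul_mem_mul ih (Ideal.pow_le_self (Nat.succ_ne_zero k) ih))

theorem eq_zero_of_forall_dvd {a : ℤ_[p]⟦X⟧} (h : ∀ n : ℕ, ∃ k, n ≤ k ∧
    (((Polynomial.X + 1 : ℤ_[p][X]) ^ p ^ k - 1 : ℤ_[p][X]) : ℤ_[p]⟦X⟧) ∣ a) : a = 0 := by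
  have hm := Ideal.iInf_pow_eq_bot_of_isLocalRing (IsLocalRing.maximalIdeal ℤ_[p]⟦X⟧)
    Ideal.IsPrime.ne_top'
  rw [← Submodule.mem_bot (R := ℤ_[p]⟦X⟧), ← hm, Submodule.mem_iInf]
  intro n
  obtain ⟨k, hk, c, rfl⟩ := h n
  refine Ideal.mul_mem_right _ _ (Ideal.pow_le_pow_right (hk.trans k.le_succ) ?_)
  have := X_add_one_pow_sub_one_mem (p := p) k
  simpa using this

end KrullIntersection

/-! ### The identification of `ℤ_p[[Γ]]` with `ℤ_p⟦X⟧`. -/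

section Iso

open scoped PowerSeries.WithPiTopology

variable {p : ℕ} [Fact p.Prime] {Γ : Type*} [CommGroup Γ] [TopologicalSpace Γ]
  [IsTopologicalGroup Γ]

theorem isCompact_setOf_dvd_sub (a ω : ℤ_[p]⟦X⟧) :
    IsCompact {b : ℤ_[p]⟦X⟧ | ω ∣ b - a} := by
  have : CompactSpace ℤ_[p]⟦X⟧ := inferInstanceAs (CompactSpace ((Unit →₀ ℕ) → ℤ_[p]))
  have h : {b : ℤ_[p]⟦X⟧ | ω ∣ b - a} = Set.range fun c => a + ω * c := by
    ext b
    constructor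
    · rintro ⟨c, hc⟩
      exact ⟨c, by simp only [← hc]; ring⟩
    · rintro ⟨c, rfl⟩
      exact ⟨c, by ring⟩
  rw [h]
  exact isCompact_range (by fun_prop)

/-- The isomorphism of the Iwasawa algebra with the power series ring sending `γ - 1` to `T`. -/
theorem exists_algEquiv_powerSeries (hΓ : Nonempty (Γ ≃ₜ* Multiplicative ℤ_[p]))
    {γ : Γ} (hγ : (Subgroup.zpowers γ).topologicalClosure = ⊤) :
    ∃ e : IwasawaAlgebra p Γ ≃ₐ[ℤ_[p]] ℤ_[p]⟦X⟧, e (groupElement p γ - 1) = X := by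
  obtain ⟨E⟩ := hΓ
  choose k hk using exists_orderOf_mk_eq_pow E γ
  choose φ hφ hsurj hker using fun U =>
    exists_algHom_groupRing (p := p) (hk U) (mem_powers_mk E hγ U)
  have hcompat : ∀ (U V : OpenNormalSubgroup Γ) (h : U ≤ V),
      (transition p h).comp (φ U) = φ V := by
    intro U V h
    have h1 : ∀ f : ℤ_[p][X], (transition p h).comp (φ U) f = φ V f := by
      intro f
      rw [AlgHom.comp_apply, hφ, hφ, ← Polynomial.aeval_algHom_apply, map_sub, map_one]
      congr 3
      exact MonoidAlgebra.mapDomain_single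
    refine algHom_ext_of_eq_on_polynomial h1 (isDistinguishedAt_X_add_one_pow_sub_one (k U)) ?_
    rw [AlgHom.comp_apply, (hker U _).mpr dvd_rfl, map_zero]
  let Φ : ℤ_[p]⟦X⟧ →ₐ[ℤ_[p]] compatibleFamilies p Γ :=
    (AlgHom.pi φ).codRestrict (compatibleFamilies p Γ) fun a U V h =>
      DFunLike.congr_fun (hcompat U V h) a
  have hinj : Function.Injective Φ := by
    rw [injective_iff_map_eq_zero]
    intro a ha
    refine eq_zero_of_forall_dvd fun n => ?_
    obtain ⟨U, m, hm, hU⟩ := exists_le_orderOf_mk E hγ n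
    refine ⟨m, hm, ?_⟩
    have hkm : k U = m := Nat.pow_right_injective (Nat.Prime.two_le Fact.out) ((hk U).symm.trans hU)
    rw [← hkm, ← hker U]
    exact congrFun (congrArg Subtype.val ha) U
  -- The power series with prescribed image at level `U` form a nonempty compact set, a coset of a
  -- principal ideal. These sets are directed, so they have a common point.
  have hsur : Function.Surjective Φ := by
    rintro ⟨x, hx⟩
    have hset : ∀ U a, φ U a = x U → {b | φ U b = x U} =
        {b | (((Polynomial.X + 1 : ℤ_[p][X]) ^ p ^ k U - 1 : ℤ_[p][X]) : ℤ_[p]⟦X⟧) ∣ b - a} := by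
      intro U a ha
      ext b
      rw [Set.mem_ofPred_eq, Set.mem_ofPred_eq, ← hker, map_sub, ha, sub_eq_zero]
    have hc : ∀ U, IsCompact {b | φ U b = x U} := fun U => by
      obtain ⟨a, ha⟩ := hsurj U (x U)
      rw [hset U a ha]
      exact isCompact_setOf_dvd_sub _ _
    have : Nonempty (OpenNormalSubgroup Γ) := ⟨levelSubgroup E 0⟩
    have hdir : Directed (fun s t : Set ℤ_[p]⟦X⟧ => s ⊇ t)
        (fun U : OpenNormalSubgroup Γ => {b | φ U b = x U}) := by
      have hle : ∀ {U W : OpenNormalSubgroup Γ}, W ≤ U →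
          {b | φ W b = x W} ⊆ {b | φ U b = x U} := fun {U W} h b hb => by
        change φ U b = x U
        rw [← hx W U h, ← hcompat W U h, AlgHom.comp_apply]
        exact congrArg _ hb
      exact fun U V => ⟨U ⊓ V, hle inf_le_left, hle inf_le_right⟩
    obtain ⟨b, hb⟩ := IsCompact.nonempty_iInter_of_directed_nonempty_isCompact_isClosed _ hdir
      (fun U => hsurj U (x U)) hc (fun U => (hc U).isClosed)
    exact ⟨b, Subtype.ext (funext fun U => Set.mem_iInter.mp hb U)⟩
  let e : ℤ_[p]⟦X⟧ ≃ₐ[ℤ_[p]] IwasawaAlgebra p Γ := AlgEquiv.ofBijective Φ ⟨hinj, hsur⟩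
  refine ⟨e.symm, ?_⟩
  rw [AlgEquiv.symm_apply_eq]
  refine Subtype.ext (funext fun U => ?_)
  change _ = φ U X
  rw [← Polynomial.coe_X, hφ, Polynomial.aeval_X]
  rfl

end Iso

/-! ### Lifting a decomposition from a localization. -/

section Lift

variable {A : Type*} [CommRing A]

theorem exists_mem_smul_eq_zero_of_fg {N : Type*} [AddCommGroup N] [Module A N]
    [Module.Finite A N] (S : Submonoid A) (h : ∀ n : N, ∃ s ∈ S, s • n = 0) :
    ∃ s ∈ S, ∀ n : N, s • n = 0 := by
  obtain ⟨t, ht⟩ := Module.Finite.fg_top (R := A) (M := N)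
  choose σ hσ hσ' using h
  refine ⟨∏ i ∈ t, σ i, prod_mem fun i _ => hσ i, fun n => ?_⟩
  have hn : n ∈ Submodule.span A (t : Set N) := ht ▸ Submodule.mem_top
  induction hn using Submodule.span_induction with
  | mem x hx =>
    obtain ⟨c, hc⟩ := Finset.dvd_prod_of_mem σ hx
    rw [hc, mul_comm, mul_smul, hσ', smul_zero]
  | zero => exact smul_zero _
  | add x y _ _ hx hy => rw [smul_add, hx, hy, add_zero]
  | smul a x _ hx => rw [smul_comm, hx, smul_zero]

/-- A finitely generated torsion module over a Noetherian domain maps to a direct sum of cyclic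
modules, up to the denominators of a localization which is a principal ideal domain. -/
theorem exists_map_of_localization_isPrincipalIdealRing [IsDomain A] [IsNoetherianRing A]
    {S : Submonoid A} (hS : S ≤ nonZeroDivisors A) [IsDomain (Localization S)]
    [IsPrincipalIdealRing (Localization S)] {X : Type*} [AddCommGroup X] [Module A X]
    [Module.Finite A X] (hX : Module.IsTorsion A X) (P : A → Prop)
    (hP : ∀ b : Localization S, b ≠ 0 → ∃ a, P a ∧ Associated b (algebraMap A _ a)) :
    ∃ (n : ℕ) (g : Fin n → A) (ψ : X →ₗ[A] ((i : Fin n) → A ⧸ Ideal.span {g i})),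
      (∀ i, P (g i)) ∧ (∃ s ∈ S, ∀ x, ψ x = 0 → s • x = 0) ∧
        ∃ s ∈ S, ∀ y, ∃ x, ψ x = s • y := by
  set B := Localization S with hB
  have hinj : Function.Injective (algebraMap A B) := IsLocalization.injective B hS
  have htors : Module.IsTorsion B (LocalizedModule S X) := by
    intro y
    induction y using LocalizedModule.induction_on with
    | h x s =>
      obtain ⟨a, ha⟩ := @hX x
      refine ⟨⟨algebraMap A B a, mem_nonZeroDivisors_of_ne_zero
        ((map_ne_zero_iff _ hinj).mpr (nonZeroDivisors.ne_zero a.2))⟩, ?_⟩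
      change algebraMap A B a • LocalizedModule.mk x s = 0
      rw [algebraMap_smul, LocalizedModule.smul'_mk]
      change LocalizedModule.mk (a • x) s = 0
      rw [ha, LocalizedModule.zero_mk]
  -- Over the localization the module is a sum of cyclic ones. Their generators are replaced by
  -- associates coming from `A` and satisfying `P`, so that the target is itself a localized module.
  obtain ⟨ι, _, q, hq, m, ⟨E⟩⟩ := Module.equiv_directSum_of_isTorsion htors
  classical
  choose g' hg' hassoc using fun i => hP (q i ^ m i) (pow_ne_zero _ (hq i).ne_zero)
  let τ := (Fintype.equivFin ι).symm
  let g : Fin (Fintype.card ι) → A := fun i => g' (τ i)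
  let f : ∀ i, (A ⧸ Ideal.span {g i}) →ₗ[A]
      B ⧸ (Ideal.span {g i}).localized' B S (Algebra.linearMap A B) :=
    fun i => Submodule.toLocalizedQuotient' B S (Algebra.linearMap A B) (Ideal.span {g i})
  let F := LinearMap.pi fun i => f i ∘ₗ LinearMap.proj i
  have hF : IsLocalizedModule S F := IsLocalizedModule.pi S f
  have hspan : ∀ i, (B ∙ q (τ i) ^ m (τ i)) =
      (Ideal.span {g i}).localized' B S (Algebra.linearMap A B) := by
    intro i
    refine Eq.trans ?_ (Submodule.localized'_span B S (Algebra.linearMap A B) {g i}).symm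
    rw [Set.image_singleton]
    exact Ideal.span_singleton_eq_span_singleton.mpr (hassoc (τ i))
  let E' : LocalizedModule S X ≃ₗ[B]
      ((i : Fin (Fintype.card ι)) → B ⧸ (Ideal.span {g i}).localized' B S (Algebra.linearMap A B)) :=
    E.trans <| (DirectSum.linearEquivFunOnFintype B ι (fun i => B ⧸ B ∙ q i ^ m i)).trans <|
      (LinearEquiv.piCongrLeft B (fun i => B ⧸ B ∙ q i ^ m i) τ).symm.trans <|
      LinearEquiv.piCongrRight fun i => Submodule.quotEquivOfEq _ _ (hspan i)
  have := Module.finitePresentation_of_finite A X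
  -- Finite presentation lets the isomorphism descend to `A` after multiplication by one denominator
  -- `s`.
  obtain ⟨ψ, s, hψ⟩ := Module.FinitePresentation.exists_lift_of_isLocalizedModule S F
    ((E'.restrictScalars A).toLinearMap ∘ₗ LocalizedModule.mkLinearMap S X)
  have hψ' : ∀ x, F (ψ x) = s • E' (LocalizedModule.mkLinearMap S X x) :=
    fun x => LinearMap.congr_fun hψ x
  have hE : ∀ (a : A) z, E' (a • z) = a • E' z := (E'.restrictScalars A).map_smul
  refine ⟨_, g, ψ, fun i => hg' _, ?_, ?_⟩
  · have := exists_mem_smul_eq_zero_of_fg (N := LinearMap.ker ψ) S fun x => by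
      have h1 := hψ' x
      rw [LinearMap.mem_ker.mp x.2, map_zero] at h1
      have h2 : E' (LocalizedModule.mkLinearMap S X ((s : A) • (x : X))) = 0 := by
        rw [map_smul, hE]
        exact h1.symm
      obtain ⟨c, hc⟩ := (IsLocalizedModule.eq_zero_iff S (LocalizedModule.mkLinearMap S X)).mp
        ((map_eq_zero_iff E' E'.injective).mp h2)
      exact ⟨c * s, mul_mem c.2 s.2, Subtype.ext ((mul_smul _ _ _).trans hc)⟩
    obtain ⟨s, hs, h⟩ := this
    exact ⟨s, hs, fun x hx => congrArg Subtype.val (h ⟨x, hx⟩)⟩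
  · have := exists_mem_smul_eq_zero_of_fg
      (N := ((i : Fin (Fintype.card ι)) → A ⧸ Ideal.span {g i}) ⧸ LinearMap.range ψ) S fun y => by
      obtain ⟨y, rfl⟩ := Submodule.Quotient.mk_surjective _ y
      obtain ⟨⟨x, t⟩, hx⟩ := IsLocalizedModule.surj S (LocalizedModule.mkLinearMap S X)
        (E'.symm (F y))
      have h1 : F (ψ x) = F ((s * t : A) • y) := by
        rw [hψ', ← hx, mul_smul, map_smul F, map_smul F]
        change (s : A) • E' ((t : A) • E'.symm (F y)) = _
        rw [hE, E'.apply_symm_apply]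
      obtain ⟨c, hc⟩ := IsLocalizedModule.exists_of_eq (S := S) h1
      refine ⟨c * (s * t), mul_mem c.2 (mul_mem s.2 t.2), ?_⟩
      rw [← Submodule.Quotient.mk_smul, Submodule.Quotient.mk_eq_zero, mul_smul]
      exact ⟨(c : A) • x, by rw [map_smul]; exact hc⟩
    obtain ⟨s, hs, h⟩ := this
    refine ⟨s, hs, fun y => ?_⟩
    have := h (Submodule.Quotient.mk y)
    rwa [← Submodule.Quotient.mk_smul, Submodule.Quotient.mk_eq_zero] at this

theorem exists_associated_algebraMap {S : Submonoid A} (b : Localization S) (hb : b ≠ 0) :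
    ∃ a : A, a ≠ 0 ∧ Associated b (algebraMap A (Localization S) a) := by
  obtain ⟨a, s, h⟩ := IsLocalization.exists_mk'_eq S b
  refine ⟨a, ?_, ?_⟩
  · rintro rfl
    exact hb (h.symm.trans (IsLocalization.mk'_zero s))
  · rw [← IsLocalization.mk'_spec (Localization S) a s, h]
    exact associated_mul_unit_right _ _ (IsLocalization.map_units _ s)

end Lift

/-! ### `Λ[1/p]` is a principal ideal domain. -/

section StructureTheorem

variable {p : ℕ} [Fact p.Prime] {A : Type*} [CommRing A] [Algebra ℤ_[p] A]
  (e : A ≃ₐ[ℤ_[p]] ℤ_[p]⟦X⟧) {T : A} (hT : e T = PowerSeries.X)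

include e hT

theorem distinguished_of_not_dvd {s : A} (hs : ¬ (p : A) ∣ s) :
    ∃ (u : A) (f : ℤ_[p][X]), IsUnit u ∧ f.IsDistinguishedAt (Ideal.span {(p : ℤ_[p])}) ∧
      s = u * Polynomial.aeval T f := by
  obtain ⟨k, u, f, hu, hf, h, -⟩ := exists_factorization e hT
    (a := s) fun h => hs (h ▸ dvd_zero _)
  rcases Nat.eq_zero_or_pos k with rfl | hk
  · exact ⟨u, f, hu, hf, by rw [h, pow_zero, one_mul]⟩
  · exact absurd (h ▸ Dvd.dvd.mul_right (dvd_pow_self _ hk.ne') _) hs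

theorem exists_associated_distinguished (b : Localization (Submonoid.powers (p : A)))
    (hb : b ≠ 0) : ∃ f : ℤ_[p][X], f.IsDistinguishedAt (Ideal.span {(p : ℤ_[p])}) ∧
      Associated b (algebraMap A _ (Polynomial.aeval T f)) := by
  obtain ⟨a, ha, h1⟩ := exists_associated_algebraMap b hb
  set S := Submonoid.powers (p : A)
  obtain ⟨k, u, f, hu, hf, h, -⟩ := exists_factorization e hT ha
  refine ⟨f, hf, ?_⟩
  refine h1.trans ?_
  have hp : IsUnit (algebraMap A (Localization S) ((p : A) ^ k)) :=
    IsLocalization.map_units _ (⟨(p : A) ^ k, k, rfl⟩ : S)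
  rw [h, ← mul_assoc, map_mul]
  refine associated_unit_mul_left _ _ ?_
  rw [map_mul]
  exact hp.mul (hu.map _)

/-- A distinguished polynomial of least degree in the ideal generates it, by Weierstrass division.
-/
theorem isPrincipalIdealRing_localization_powers :
    IsPrincipalIdealRing (Localization (Submonoid.powers (p : A))) := by
  classical
  set S := Submonoid.powers (p : A)
  set B := Localization S
  refine ⟨fun J => ?_⟩
  by_cases hJ : J = ⊥
  · exact hJ ▸ ⟨0, by simp⟩
  have hex : ∃ d : ℕ, ∃ f : ℤ_[p][X], f.IsDistinguishedAt (Ideal.span {(p : ℤ_[p])}) ∧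
      algebraMap A B (Polynomial.aeval T f) ∈ J ∧ f.natDegree = d := by
    obtain ⟨b, hbJ, hb⟩ := Submodule.exists_mem_ne_zero_of_ne_bot hJ
    obtain ⟨f, hf, h⟩ := exists_associated_distinguished e hT b hb
    exact ⟨_, f, hf, J.mem_of_dvd h.dvd hbJ, rfl⟩
  obtain ⟨f, hf, hfJ, hd⟩ := Nat.find_spec hex
  have hmin : ∀ f' : ℤ_[p][X], f'.IsDistinguishedAt (Ideal.span {(p : ℤ_[p])}) →
      algebraMap A B (Polynomial.aeval T f') ∈ J → f.natDegree ≤ f'.natDegree :=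
    fun f' h1 h2 => hd ▸ Nat.find_min' hex ⟨f', h1, h2, rfl⟩
  refine ⟨algebraMap A B (Polynomial.aeval T f), le_antisymm (fun b hb => ?_)
    ((Ideal.span_singleton_le_iff_mem J).mpr hfJ)⟩
  refine Ideal.mem_span_singleton.mpr ?_
  rcases eq_or_ne b 0 with rfl | hb0
  · exact dvd_zero _
  obtain ⟨f₁, -, h₁⟩ := exists_associated_distinguished e hT b hb0
  have hJ₁ := J.mem_of_dvd h₁.dvd hb
  refine Dvd.dvd.trans ?_ h₁.symm.dvd
  obtain ⟨q, r, hqr, hdeg⟩ := exists_division e hT hf (Polynomial.aeval T f₁)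
  rcases eq_or_ne r 0 with rfl | hr
  · rw [hqr, map_zero, add_zero, map_mul]
    exact dvd_mul_right _ _
  exfalso
  -- A nonzero remainder `r` need not be distinguished, but its Weierstrass polynomial `f₂` also
  -- lies in the ideal and has degree at most that of `r`, contradicting minimality.
  obtain ⟨k, u, f₂, hu, hf₂, h, hc⟩ := exists_factorization e hT
    (a := Polynomial.aeval T r) ((aeval_eq_zero_iff e hT).not.mpr hr)
  have hrJ : algebraMap A B (Polynomial.aeval T r) ∈ J := by
    rw [hqr, map_add, map_mul] at hJ₁
    exact (Ideal.add_mem_iff_right J (J.mul_mem_right _ hfJ)).mp hJ₁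
  have hf₂J : algebraMap A B (Polynomial.aeval T f₂) ∈ J := by
    have hp : IsUnit (algebraMap A B ((p : A) ^ k)) :=
      IsLocalization.map_units _ (⟨(p : A) ^ k, k, rfl⟩ : S)
    rw [h, map_mul, map_mul] at hrJ
    exact (Ideal.unit_mul_mem_iff_mem J (hu.map _)).mp ((Ideal.unit_mul_mem_iff_mem J hp).mp hrJ)
  rw [apply_aeval e hT, Polynomial.coeff_coe] at hc
  have h1 := Polynomial.le_natDegree_of_ne_zero hc
  have h2 := Polynomial.natDegree_lt_natDegree hr hdeg
  exact absurd (hmin f₂ hf₂ hf₂J) (by omega)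

end StructureTheorem

/-! ### `Λ_(p)` is a principal ideal ring whose nonzero ideals are generated by powers of `p`. -/

section Residue

variable {p : ℕ} [Fact p.Prime] {A : Type*} [CommRing A] [Algebra ℤ_[p] A]
  (e : A ≃ₐ[ℤ_[p]] ℤ_[p]⟦X⟧)

include e

theorem isDomain_of_algEquiv : IsDomain A :=
  (e : A ≃* ℤ_[p]⟦X⟧).isDomain _

theorem isNoetherianRing_of_algEquiv : IsNoetherianRing A :=
  isNoetherianRing_of_ringEquiv ℤ_[p]⟦X⟧ (e : A ≃+* ℤ_[p]⟦X⟧).symm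

theorem isPrime_span_natCast : (Ideal.span {(p : A)}).IsPrime :=
  (Ideal.span_singleton_prime (natCast_prime_of_algEquiv e).ne_zero).mpr
    (natCast_prime_of_algEquiv e)

theorem exists_associated_pow [(Ideal.span {(p : A)}).IsPrime]
    (b : Localization (Ideal.span {(p : A)}).primeCompl) (hb : b ≠ 0) :
    ∃ k : ℕ, Associated b (algebraMap A _ ((p : A) ^ k)) := by
  have := isDomain_of_algEquiv e
  have := isNoetherianRing_of_algEquiv e
  obtain ⟨a, ha, h1⟩ := exists_associated_algebraMap b hb
  set S := (Ideal.span {(p : A)}).primeCompl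
  have hfin : FiniteMultiplicity (p : A) a :=
    FiniteMultiplicity.of_not_isUnit (natCast_prime_of_algEquiv e).not_isUnit ha
  obtain ⟨c, hac, hc⟩ := hfin.exists_eq_pow_mul_and_not_dvd
  refine ⟨multiplicity (p : A) a, ?_⟩
  refine h1.trans ?_
  have hu : IsUnit (algebraMap A (Localization S) c) :=
    IsLocalization.map_units _ (⟨c, fun h => hc (Ideal.mem_span_singleton.mp h)⟩ : S)
  have h2 : algebraMap A (Localization S) a =
      algebraMap A _ ((p : A) ^ multiplicity (p : A) a) * algebraMap A _ c := by
    rw [← map_mul, ← hac]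
  rw [h2]
  exact associated_mul_unit_left _ _ hu

theorem isPrincipalIdealRing_localization_primeCompl [(Ideal.span {(p : A)}).IsPrime] :
    IsPrincipalIdealRing (Localization (Ideal.span {(p : A)}).primeCompl) := by
  classical
  set S := (Ideal.span {(p : A)}).primeCompl
  set B := Localization S
  refine ⟨fun J => ?_⟩
  by_cases hJ : J = ⊥
  · exact hJ ▸ ⟨0, by simp⟩
  have hex : ∃ k : ℕ, algebraMap A B ((p : A) ^ k) ∈ J := by
    obtain ⟨b, hbJ, hb⟩ := Submodule.exists_mem_ne_zero_of_ne_bot hJ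
    obtain ⟨k, h⟩ := exists_associated_pow e b hb
    exact ⟨k, J.mem_of_dvd h.dvd hbJ⟩
  refine ⟨algebraMap A B ((p : A) ^ Nat.find hex), le_antisymm (fun b hb => ?_)
    ((Ideal.span_singleton_le_iff_mem J).mpr (Nat.find_spec hex))⟩
  refine Ideal.mem_span_singleton.mpr ?_
  rcases eq_or_ne b 0 with rfl | hb0
  · exact dvd_zero _
  obtain ⟨k, h⟩ := exists_associated_pow e b hb0
  refine Dvd.dvd.trans ?_ h.symm.dvd
  exact map_dvd _ (pow_dvd_pow _ (Nat.find_min' hex (J.mem_of_dvd h.dvd hb)))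

end Residue

/-! ### The structure theorem up to finite kernel and cokernel. -/

section ElementaryModule

variable {p : ℕ} [Fact p.Prime] {A : Type*} [CommRing A] [Algebra ℤ_[p] A]

theorem isDistinguishedAt_finset_prod {ι : Type*} (s : Finset ι) (f : ι → ℤ_[p][X])
    (h : ∀ i, (f i).IsDistinguishedAt (Ideal.span {(p : ℤ_[p])})) :
    (∏ i ∈ s, f i).IsDistinguishedAt (Ideal.span {(p : ℤ_[p])}) := by
  classical
  induction s using Finset.induction_on with
  | empty =>
    rw [Finset.prod_empty]
    exact { mem := fun {n} hn => by simp at hn, monic := Polynomial.monic_one }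
  | insert i s hi ih => rw [Finset.prod_insert hi]; exact (h i).mul ih

theorem smul_pi_quotient_eq_zero {ι : Type*} {g : ι → A} {a : A} (h : ∀ i, g i ∣ a)
    (y : (i : ι) → A ⧸ Ideal.span {g i}) : a • y = 0 := by
  ext i
  obtain ⟨z, hz⟩ := Ideal.Quotient.mk_surjective (y i)
  rw [Pi.smul_apply, Pi.zero_apply, ← hz]
  change Ideal.Quotient.mk _ (a * z) = 0
  exact Ideal.Quotient.eq_zero_iff_mem.mpr
    (Ideal.mul_mem_right _ _ (Ideal.mem_span_singleton.mpr (h i)))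

/-- The structure theorem: a finitely generated torsion module over a power series ring over `ℤ_p`
maps to an elementary module with finite kernel and cokernel. -/
theorem exists_elementary_pseudoIsomorphism (e : A ≃ₐ[ℤ_[p]] ℤ_[p]⟦X⟧) {T : A}
    (hT : e T = PowerSeries.X) {X : Type*} [AddCommGroup X] [Module A X] [Module.Finite A X]
    (hX : Module.IsTorsion A X) :
    ∃ (D : ElementaryData p) (ψ : X →ₗ[A]
      ((i : Fin D.n) → A ⧸ Ideal.span {Polynomial.aeval T (D.f i)}) ×
        ((j : Fin D.m) → A ⧸ Ideal.span {(p : A) ^ D.exponent j})),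
      Finite (LinearMap.ker ψ) ∧ Finite ((((i : Fin D.n) → A ⧸ Ideal.span {Polynomial.aeval T (D.f i)}) ×
        ((j : Fin D.m) → A ⧸ Ideal.span {(p : A) ^ D.exponent j})) ⧸ LinearMap.range ψ) := by
  have := isDomain_of_algEquiv e
  have := isNoetherianRing_of_algEquiv e
  have hprime := isPrime_span_natCast e
  have hp0 : (p : A) ≠ 0 := (natCast_prime_of_algEquiv e).ne_zero
  have hS₁ : Submonoid.powers (p : A) ≤ nonZeroDivisors A :=
    powers_le_nonZeroDivisors_of_noZeroDivisors hp0
  have := IsLocalization.isDomain_localization hS₁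
  have := isPrincipalIdealRing_localization_powers e hT
  have := IsLocalization.isDomain_localization (Ideal.primeCompl_le_nonZeroDivisors (Ideal.span {(p : A)}))
  have := isPrincipalIdealRing_localization_primeCompl e
  -- Inverting `p` gives the summands `Λ/(f_i)`, with errors killed by powers of `p`; localizing at
  -- `(p)` below gives the summands `Λ/(p^μ_j)`, with errors killed by elements prime to `p`.
  obtain ⟨n, g, ψ₁, hg, ⟨_, ⟨k₁, rfl⟩, hker₁⟩, ⟨_, ⟨k₂, rfl⟩, hcoker₁⟩⟩ :=
    exists_map_of_localization_isPrincipalIdealRing hS₁ hX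
      (fun a => ∃ f : ℤ_[p][X], f.IsDistinguishedAt (Ideal.span {(p : ℤ_[p])}) ∧
        Polynomial.aeval T f = a)
      (fun b hb => by
        obtain ⟨f, hf, h⟩ := exists_associated_distinguished e hT b hb
        exact ⟨_, ⟨f, hf, rfl⟩, h⟩)
  obtain ⟨m, g', ψ₂, hg', ⟨s₁, hs₁, hker₂⟩, ⟨s₂, hs₂, hcoker₂⟩⟩ :=
    exists_map_of_localization_isPrincipalIdealRing
      (Ideal.primeCompl_le_nonZeroDivisors (Ideal.span {(p : A)})) hX
      (fun a => ∃ k : ℕ, (p : A) ^ k = a)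
      (fun b hb => by
        obtain ⟨k, h⟩ := exists_associated_pow e b hb
        exact ⟨_, ⟨k, rfl⟩, h⟩)
  choose f hf hfg using hg
  choose ex hex using hg'
  obtain rfl : (fun i => Polynomial.aeval T (f i)) = g := funext hfg
  obtain rfl : (fun j => (p : A) ^ ex j) = g' := funext hex
  refine ⟨⟨n, f, hf, m, ex⟩, ψ₁.prod ψ₂, ?_, ?_⟩
  · obtain ⟨u, F, hu, hF, rfl⟩ := distinguished_of_not_dvd e hT
      (fun h => hs₁ (Ideal.mem_span_singleton.mpr h))
    refine finite_of_pow_smul_of_aeval_smul e hT hF (k := k₁) (fun x => ?_) (fun x => ?_)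
    · exact Subtype.ext (hker₁ x (congrArg Prod.fst (LinearMap.mem_ker.mp x.2)))
    · have h := hker₂ x (congrArg Prod.snd (LinearMap.mem_ker.mp x.2))
      rw [mul_smul, hu.smul_eq_zero] at h
      exact Subtype.ext h
  · obtain ⟨u, F, hu, hF, rfl⟩ := distinguished_of_not_dvd e hT
      (fun h => hs₂ (Ideal.mem_span_singleton.mpr h))
    set ψ := ψ₁.prod ψ₂ with hψ
    set F₀ : ℤ_[p][X] := ∏ i, f i with hF₀
    have hF₀d := isDistinguishedAt_finset_prod Finset.univ f hf
    have hE₁ : ∀ y : (i : Fin n) → A ⧸ Ideal.span {Polynomial.aeval T (f i)},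
        Polynomial.aeval T F₀ • y = 0 :=
      smul_pi_quotient_eq_zero fun i => map_dvd _ (Finset.dvd_prod_of_mem f (Finset.mem_univ i))
    have hE₂ : ∀ y : (j : Fin m) → A ⧸ Ideal.span {(p : A) ^ ex j},
        (p : A) ^ (∑ j, ex j) • y = 0 :=
      smul_pi_quotient_eq_zero fun j => pow_dvd_pow _
        (Finset.single_le_sum (fun _ _ => Nat.zero_le _) (Finset.mem_univ j))
    let π := (LinearMap.range ψ).mkQ
    let π₁ := π ∘ₗ LinearMap.inl A _ _
    let π₂ := π ∘ₗ LinearMap.inr A _ _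
    have h₁ : Finite (LinearMap.range π₁) := by
      refine finite_of_pow_smul_of_aeval_smul e hT hF₀d (k := (∑ j, ex j) + k₂) ?_ ?_
      · rintro ⟨_, y, rfl⟩
        obtain ⟨x, hx⟩ := hcoker₁ y
        refine Subtype.ext ?_
        change (p : A) ^ ((∑ j, ex j) + k₂) • π (y, 0) = 0
        rw [← map_smul]
        -- The factor `p^(∑ ex j)` annihilates the second component of `ψ x`, so only the first
        -- survives; symmetrically `F₀` annihilates the first component in `h₂`.
        refine (Submodule.Quotient.mk_eq_zero _).mpr ⟨(p : A) ^ (∑ j, ex j) • x, ?_⟩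
        rw [map_smul, hψ, LinearMap.prod_apply]
        refine Prod.ext ?_ ?_
        · change (p : A) ^ (∑ j, ex j) • ψ₁ x = (p : A) ^ ((∑ j, ex j) + k₂) • y
          rw [hx, pow_add, mul_smul]
        · exact (hE₂ _).trans (smul_zero _).symm
      · rintro ⟨_, y, rfl⟩
        refine Subtype.ext ?_
        change Polynomial.aeval T F₀ • π₁ y = 0
        rw [← map_smul, hE₁, map_zero]
    have h₂ : Finite (LinearMap.range π₂) := by
      refine finite_of_pow_smul_of_aeval_smul e hT (hF₀d.mul hF) (k := ∑ j, ex j) ?_ ?_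
      · rintro ⟨_, y, rfl⟩
        refine Subtype.ext ?_
        change (p : A) ^ (∑ j, ex j) • π₂ y = 0
        rw [← map_smul, hE₂, map_zero]
      · rintro ⟨_, y, rfl⟩
        obtain ⟨x, hx⟩ := hcoker₂ y
        refine Subtype.ext ?_
        change Polynomial.aeval T (F₀ * F) • π (0, y) = 0
        rw [← hu.smul_eq_zero, ← mul_smul, ← map_smul]
        refine (Submodule.Quotient.mk_eq_zero _).mpr ⟨Polynomial.aeval T F₀ • x, ?_⟩
        rw [map_smul, hψ, LinearMap.prod_apply]
        refine Prod.ext ?_ ?_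
        · exact (hE₁ _).trans (smul_zero _).symm
        · change Polynomial.aeval T F₀ • ψ₂ x = (u * Polynomial.aeval T (F₀ * F)) • y
          rw [hx, map_mul, smul_smul]
          congr 1
          ring
    -- The cokernel is the sum of the images of the two summands, each of which is finite.
    refine Finite.of_surjective
      (fun x : LinearMap.range π₁ × LinearMap.range π₂ => (x.1 : _) + (x.2 : _)) fun z => ?_
    obtain ⟨⟨y₁, y₂⟩, rfl⟩ := Submodule.Quotient.mk_surjective _ z
    refine ⟨⟨⟨π₁ y₁, y₁, rfl⟩, ⟨π₂ y₂, y₂, rfl⟩⟩, ?_⟩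
    change π (y₁, 0) + π (0, y₂) = π (y₁, y₂)
    rw [← map_add, Prod.mk_add_mk, add_zero, zero_add]

end ElementaryModule

/-! ### Herbrand quotients of abelian groups. -/

section Index

variable {A B C : Type*} [AddCommGroup A] [AddCommGroup B] [AddCommGroup C]

theorem card_ker_comp (f : A →+ B) (g : B →+ C) :
    Nat.card (g.comp f).ker = Nat.card f.ker * Nat.card (f.range ⊓ g.ker : AddSubgroup B) := by
  have hle : f.ker ≤ (g.comp f).ker := fun a ha => by
    rw [AddMonoidHom.mem_ker] at ha ⊢
    rw [AddMonoidHom.comp_apply, ha, map_zero]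
  have h1 := AddSubgroup.relIndex_mul_relIndex _ _ _ bot_le hle
  rw [AddSubgroup.relIndex_bot_left, AddSubgroup.relIndex_bot_left] at h1
  rw [← h1, ← AddMonoidHom.comap_ker, ← AddMonoidHom.comap_bot f, AddSubgroup.relIndex_comap,
    AddSubgroup.map_comap_eq, AddSubgroup.relIndex_bot_left]

theorem index_range_comp (f : A →+ B) (g : B →+ C) :
    (g.comp f).range.index = (f.range ⊔ g.ker).index * g.range.index := by
  rw [AddMonoidHom.range_comp, ← AddSubgroup.relIndex_mul_index (AddSubgroup.map_le_range g f.range)]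
  congr 1
  rw [← AddSubgroup.comap_map_eq, ← AddSubgroup.relIndex_top_right, AddSubgroup.relIndex_comap,
    ← AddMonoidHom.range_eq_map]

/-- Multiplicativity of the Herbrand quotient, cleared of denominators. No finiteness is needed,
with infinite orders and indices counted as `0`. -/
theorem card_ker_comp_mul_index (f : A →+ B) (g : B →+ C) :
    Nat.card (g.comp f).ker * (f.range.index * g.range.index) =
      (g.comp f).range.index * (Nat.card f.ker * Nat.card g.ker) := by
  have h1 : f.range.index = f.range.relIndex g.ker * (f.range ⊔ g.ker).index := by
    rw [← AddSubgroup.relIndex_mul_index (le_sup_left : f.range ≤ f.range ⊔ g.ker), sup_comm,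
      AddSubgroup.relIndex_sup_right]
  have h2 : Nat.card g.ker =
      Nat.card (f.range ⊓ g.ker : AddSubgroup B) * f.range.relIndex g.ker := by
    rw [← AddSubgroup.inf_relIndex_right, ← AddSubgroup.relIndex_bot_left,
      ← AddSubgroup.relIndex_bot_left, AddSubgroup.relIndex_mul_relIndex _ _ _ bot_le inf_le_right]
  rw [card_ker_comp, index_range_comp, h1, h2]
  ring

/-- Quasi-isomorphisms (maps with finite kernel and cokernel) between groups with endomorphisms
transport the finiteness of the cokernel of the endomorphism. -/
theorem index_range_ne_zero_of_comm {f : A →+ B} {t : A →+ A} {t' : B →+ B}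
    (h : t'.comp f = f.comp t) (hf : f.range.index ≠ 0) (ht : t.range.index ≠ 0) :
    t'.range.index ≠ 0 := by
  have h1 : (t'.comp f).range.index ≠ 0 := by
    rw [h, index_range_comp]
    exact mul_ne_zero (ne_zero_of_dvd_ne_zero ht (AddSubgroup.index_dvd_of_le le_sup_left)) hf
  rw [index_range_comp] at h1
  exact right_ne_zero_of_mul h1

/-- Quasi-isomorphisms preserve the Herbrand quotient. -/
theorem card_ker_eq_index_range_iff_of_comm {f : A →+ B} {t : A →+ A} {t' : B →+ B}
    (h : t'.comp f = f.comp t) (hf : Finite f.ker) (hf' : f.range.index ≠ 0)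
    (ht : Finite t.ker) (ht' : t.range.index ≠ 0) (hk : Finite t'.ker) :
    Nat.card t.ker = t.range.index ↔ Nat.card t'.ker = t'.range.index := by
  have hi := index_range_ne_zero_of_comm h hf' ht'
  have e1 := card_ker_comp_mul_index f t'
  have e2 := card_ker_comp_mul_index t f
  have hC : Nat.card (f.comp t).ker ≠ 0 := by
    rw [card_ker_comp]
    have : Finite (t.range ⊓ f.ker : AddSubgroup A) :=
      Finite.of_injective _ (AddSubgroup.inclusion_injective inf_le_right)
    exact mul_ne_zero Nat.card_pos.ne' Nat.card_pos.ne'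
  have hkf : Nat.card f.ker ≠ 0 := Nat.card_pos.ne'
  have hkt : Nat.card t.ker ≠ 0 := Nat.card_pos.ne'
  have hkt' : Nat.card t'.ker ≠ 0 := Nat.card_pos.ne'
  have hI : (f.comp t).range.index ≠ 0 := by
    intro h0
    rw [h0, zero_mul] at e2
    exact mul_ne_zero hC (mul_ne_zero ht' hf') e2
  -- Both formulas now concern the same composite; the factors of `f` cancel and leave the
  -- comparison of `t` with `t'`.
  rw [h] at e1
  generalize Nat.card (f.comp t).ker = c at *
  generalize (f.comp t).range.index = i at *
  generalize Nat.card f.ker = kf at *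
  generalize Nat.card t.ker = kt at *
  generalize Nat.card t'.ker = kt' at *
  generalize f.range.index = jf at *
  generalize t.range.index = jt at *
  generalize t'.range.index = jt' at *
  constructor
  · rintro rfl
    have h3 : c * jf = i * kf := Nat.eq_of_mul_eq_mul_right (Nat.pos_of_ne_zero hkt) (by linarith)
    have h4 : (c * jf) * jt' = (c * jf) * kt' := by
      rw [mul_assoc, e1, h3]; ring
    exact (Nat.eq_of_mul_eq_mul_left (Nat.pos_of_ne_zero
      (h3 ▸ mul_ne_zero hI hkf)) h4).symm
  · rintro rfl
    have h3 : c * jf = i * kf := Nat.eq_of_mul_eq_mul_right (Nat.pos_of_ne_zero hkt') (by linarith)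
    have h4 : (c * jf) * jt = (c * jf) * kt := by
      calc (c * jf) * jt = c * (jt * jf) := by ring
        _ = _ := by rw [e2, h3]; ring
    exact (Nat.eq_of_mul_eq_mul_left (Nat.pos_of_ne_zero
      (h3 ▸ mul_ne_zero hI hkf)) h4).symm

end Index

/-! ### Pontryagin duality for `M[T] ∩ TM` and `M/(TM + M[T])`. -/

section Duality

/-- Written multiplicatively, `ℚ/ℤ` has cyclic `n`-torsion generated by `1/n`; this is what the
count of characters of a finite abelian group requires. -/
instance hasEnoughRootsOfUnity_addCircle (n : ℕ) [NeZero n] :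
    HasEnoughRootsOfUnity (Multiplicative (AddCircle (1 : ℚ))) n where
  prim := ⟨Multiplicative.ofAdd (((1 / n : ℚ) : AddCircle (1 : ℚ))), by
    have : Fact ((0 : ℚ) < 1) := ⟨one_pos⟩
    have h := AddCircle.addOrderOf_period_div (p := (1 : ℚ)) (NeZero.pos n)
    rw [← orderOf_ofAdd_eq_addOrderOf] at h
    exact IsPrimitiveRoot.iff_orderOf.mpr h⟩
  cyc := by
    have hn : (n : ℚ) ≠ 0 := Nat.cast_ne_zero.mpr (NeZero.ne n)
    let z : Multiplicative (AddCircle (1 : ℚ)) :=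
      Multiplicative.ofAdd (((1 / n : ℚ) : AddCircle (1 : ℚ)))
    have hz : z ^ n = 1 := by
      apply Multiplicative.toAdd.injective
      change n • (((1 / n : ℚ) : AddCircle (1 : ℚ))) = 0
      rw [← AddCircle.coe_nsmul, AddCircle.coe_eq_zero_iff]
      exact ⟨1, by simp [hn]⟩
    refine ⟨rootsOfUnity.mkOfPowEq z hz, fun x => ?_⟩
    obtain ⟨r, hr⟩ : ∃ r : ℚ, (r : AddCircle (1 : ℚ)) = Multiplicative.toAdd (x.1 : Multiplicative
      (AddCircle (1 : ℚ))) := QuotientAddGroup.mk_surjective _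
    have hx : n • (r : AddCircle (1 : ℚ)) = 0 := by
      have h1 := (mem_rootsOfUnity' n _).mp x.2
      have h2 := congrArg Multiplicative.toAdd h1
      rw [toAdd_pow, ← hr] at h2
      exact h2
    rw [← AddCircle.coe_nsmul, AddCircle.coe_eq_zero_iff] at hx
    obtain ⟨m, hm⟩ := hx
    refine ⟨m, Subtype.ext (Units.ext (Multiplicative.toAdd.injective ?_))⟩
    have : r = m • (1 / n : ℚ) := by
      simp only [zsmul_eq_mul, nsmul_eq_mul, mul_one] at hm ⊢
      field_simp
      linarith
    rw [← hr, this, AddCircle.coe_zsmul]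
    change Multiplicative.toAdd (((rootsOfUnity.mkOfPowEq z hz ^ m).1 : (Multiplicative
      (AddCircle (1 : ℚ)))ˣ) : Multiplicative (AddCircle (1 : ℚ))) = _
    rw [Subgroup.coe_zpow, Units.val_zpow_eq_zpow_val, toAdd_zpow]
    rfl

theorem card_characterModule (K : Type*) [AddCommGroup K] [Finite K] :
    Nat.card (CharacterModule K) = Nat.card K := by
  have : NeZero (Monoid.exponent (Multiplicative K)) := ⟨Monoid.exponent_ne_zero_of_finite⟩
  have h := CommGroup.card_monoidHom_of_hasEnoughRootsOfUnity (Multiplicative K)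
    (Multiplicative (AddCircle (1 : ℚ)))
  exact (Nat.card_congr (AddMonoidHom.toMultiplicative (α := K) (β := AddCircle (1 : ℚ)) |>.trans
    (MulEquiv.monoidHomCongrRight (M := Multiplicative K)
      (toUnits (G := Multiplicative (AddCircle (1 : ℚ))))).toEquiv)).trans h

/-- The injectivity of the divisible group `ℚ/ℤ`, applied to `A / ker f ↪ B`. -/
theorem exists_character_comp_eq {A B : Type*} [AddCommGroup A] [AddCommGroup B] (f : A →+ B)
    (χ : CharacterModule A) (h : ∀ a, f a = 0 → χ a = 0) :
    ∃ χ' : CharacterModule B, ∀ a, χ' (f a) = χ a := by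
  obtain ⟨χ', h'⟩ := (Module.Baer.of_divisible (AddCircle (1 : ℚ))).extension_property_addMonoidHom
    (QuotientAddGroup.kerLift f) (QuotientAddGroup.kerLift_injective f)
    (QuotientAddGroup.lift f.ker (χ : A →+ AddCircle (1 : ℚ)) h)
  exact ⟨χ', fun a => DFunLike.congr_fun h' (QuotientAddGroup.mk a)⟩

variable {A : Type*} [CommRing A] (T : A) (M : Type*) [AddCommGroup M] [Module A M]

theorem character_mem_range_smul_iff (χ : CharacterModule M) :
    χ ∈ LinearMap.range (LinearMap.lsmul A (CharacterModule M) T) ↔ ∀ m : M, T • m = 0 → χ m = 0 := by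
  constructor
  · rintro ⟨χ, rfl⟩ m hm
    change χ (T • m) = 0
    rw [hm, map_zero]
  · intro h
    obtain ⟨χ', h'⟩ := exists_character_comp_eq (LinearMap.lsmul A M T).toAddMonoidHom χ h
    exact ⟨χ', CharacterModule.ext _ h'⟩

theorem character_mem_ker_smul_iff (χ : CharacterModule M) :
    χ ∈ LinearMap.ker (LinearMap.lsmul A (CharacterModule M) T) ↔ ∀ m : M, χ (T • m) = 0 := by
  rw [LinearMap.mem_ker]
  exact ⟨fun h m => DFunLike.congr_fun h m, fun h => CharacterModule.ext _ h⟩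

/-- The dual of `M[T] ∩ TM`. -/
theorem card_characterModule_ker_inf_range :
    Nat.card (CharacterModule (LinearMap.ker (LinearMap.lsmul A M T) ⊓
      LinearMap.range (LinearMap.lsmul A M T) : Submodule A M)) =
    (LinearMap.range (LinearMap.lsmul A (CharacterModule M) T) ⊔
      LinearMap.ker (LinearMap.lsmul A (CharacterModule M) T)).toAddSubgroup.index := by
  set U := LinearMap.ker (LinearMap.lsmul A M T) ⊓ LinearMap.range (LinearMap.lsmul A M T)
  have hsurj := CharacterModule.dual_surjective_of_injective U.subtype U.injective_subtype
  have hker : LinearMap.ker (CharacterModule.dual U.subtype) =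
      LinearMap.range (LinearMap.lsmul A (CharacterModule M) T) ⊔
      LinearMap.ker (LinearMap.lsmul A (CharacterModule M) T) := by
    ext χ
    constructor
    · intro h
      have hU : ∀ m ∈ U, χ m = 0 := fun m hm => DFunLike.congr_fun (LinearMap.mem_ker.mp h) ⟨m, hm⟩
      -- The restriction of `χ` to `M[T]` factors through the image of `M[T]` in `M/TM` and extends
      -- to `M/TM`. The resulting `α'` is killed by `T`, while `χ - α'` vanishes on `M[T]` and so is
      -- a multiple of `T`.
      obtain ⟨α, hα⟩ := exists_character_comp_eq
        ((LinearMap.range (LinearMap.lsmul A M T)).mkQ ∘ₗ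
          (LinearMap.ker (LinearMap.lsmul A M T)).subtype).toAddMonoidHom
        (CharacterModule.dual (LinearMap.ker (LinearMap.lsmul A M T)).subtype χ)
        (fun m hm => hU m (Submodule.mem_inf.mpr
          ⟨m.2, (Submodule.Quotient.mk_eq_zero _).mp hm⟩))
      set α' := CharacterModule.dual (LinearMap.range (LinearMap.lsmul A M T)).mkQ α
      have h1 : α' ∈ LinearMap.ker (LinearMap.lsmul A (CharacterModule M) T) := by
        rw [character_mem_ker_smul_iff]
        intro m
        change α (Submodule.Quotient.mk (T • m)) = 0
        have h0 : (Submodule.Quotient.mk (T • m) : M ⧸ LinearMap.range (LinearMap.lsmul A M T)) = 0 :=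
          (Submodule.Quotient.mk_eq_zero _).mpr ⟨m, rfl⟩
        rw [h0, map_zero]
      have h2 : χ - α' ∈ LinearMap.range (LinearMap.lsmul A (CharacterModule M) T) := by
        rw [character_mem_range_smul_iff]
        intro m hm
        have : α' m = χ m := hα ⟨m, hm⟩
        change χ m - α' m = 0
        rw [this, sub_self]
      rw [← sub_add_cancel χ α']
      exact Submodule.add_mem_sup h2 h1
    · intro h
      obtain ⟨α, hα, β, hβ, rfl⟩ := Submodule.mem_sup.mp h
      rw [character_mem_range_smul_iff] at hα
      rw [character_mem_ker_smul_iff] at hβ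
      refine LinearMap.mem_ker.mpr (CharacterModule.ext _ ?_)
      rintro ⟨m, hm, n, rfl⟩
      change α (T • n) + β (T • n) = 0
      have h0 : α (T • n) = 0 := hα (T • n) hm
      rw [hβ, h0, add_zero]
  rw [← hker]
  have := AddSubgroup.index_ker (CharacterModule.dual U.subtype).toAddMonoidHom
  rw [AddMonoidHom.range_eq_top.mpr hsurj] at this
  rw [← Nat.card_congr AddSubgroup.topEquiv.toEquiv, ← this]
  rfl

/-- The dual of `M / (TM + M[T])`. -/
theorem card_characterModule_quotient :
    Nat.card (CharacterModule (M ⧸ (LinearMap.range (LinearMap.lsmul A M T) ⊔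
      LinearMap.ker (LinearMap.lsmul A M T)))) =
    Nat.card (LinearMap.ker (LinearMap.lsmul A (CharacterModule M) T) ⊓
      LinearMap.range (LinearMap.lsmul A (CharacterModule M) T) :
        Submodule A (CharacterModule M)) := by
  set V := LinearMap.range (LinearMap.lsmul A M T) ⊔ LinearMap.ker (LinearMap.lsmul A M T)
  have hinj := CharacterModule.dual_injective_of_surjective V.mkQ V.mkQ_surjective
  have hrange : LinearMap.range (CharacterModule.dual V.mkQ) =
      LinearMap.ker (LinearMap.lsmul A (CharacterModule M) T) ⊓
      LinearMap.range (LinearMap.lsmul A (CharacterModule M) T) := by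
    ext χ
    rw [Submodule.mem_inf, character_mem_ker_smul_iff, character_mem_range_smul_iff]
    constructor
    · rintro ⟨χ, rfl⟩
      have hV : ∀ m ∈ V, CharacterModule.dual V.mkQ χ m = 0 := fun m hm => by
        change χ (Submodule.Quotient.mk m) = 0
        rw [(Submodule.Quotient.mk_eq_zero _).mpr hm, map_zero]
      exact ⟨fun m => hV _ (Submodule.mem_sup_left ⟨m, rfl⟩),
        fun m hm => hV _ (Submodule.mem_sup_right hm)⟩
    · rintro ⟨h1, h2⟩
      obtain ⟨χ', h'⟩ := exists_character_comp_eq V.mkQ.toAddMonoidHom χ fun m hm => by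
        obtain ⟨_, ⟨n, rfl⟩, b, hb, rfl⟩ := Submodule.mem_sup.mp
          ((Submodule.Quotient.mk_eq_zero _).mp hm)
        rw [map_add, h2 b hb, add_zero]
        exact h1 n
      exact ⟨χ', CharacterModule.ext _ h'⟩
  rw [← hrange]
  exact Nat.card_congr (LinearEquiv.ofInjective _ hinj).toEquiv

theorem card_ker_smul_range :
    Nat.card (LinearMap.lsmul A (LinearMap.range (LinearMap.lsmul A M T)) T).toAddMonoidHom.ker =
      Nat.card (LinearMap.ker (LinearMap.lsmul A M T) ⊓
        LinearMap.range (LinearMap.lsmul A M T) : Submodule A M) := by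
  refine Nat.card_congr ⟨fun x => ⟨x.1.1, congrArg Subtype.val x.2, x.1.2⟩,
    fun x => ⟨⟨x.1, x.2.2⟩, Subtype.ext x.2.1⟩, fun x => rfl, fun x => rfl⟩

/-- The preimage of `T(TM)` under the surjection `T : M → TM` is `TM + M[T]`. -/
theorem index_range_smul_range :
    (LinearMap.lsmul A (LinearMap.range (LinearMap.lsmul A M T)) T).toAddMonoidHom.range.index =
      (LinearMap.range (LinearMap.lsmul A M T) ⊔
        LinearMap.ker (LinearMap.lsmul A M T)).toAddSubgroup.index := by
  have hs := LinearMap.surjective_rangeRestrict (LinearMap.lsmul A M T)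
  rw [← AddSubgroup.index_comap_of_surjective _
    (f := (LinearMap.lsmul A M T).rangeRestrict.toAddMonoidHom) hs]
  congr 1
  ext m
  constructor
  · rintro ⟨⟨_, n, rfl⟩, hn⟩
    have hn' : T • (T • n) = T • m := congrArg Subtype.val hn
    have h1 : m - T • n ∈ LinearMap.ker (LinearMap.lsmul A M T) := by
      rw [LinearMap.mem_ker, LinearMap.lsmul_apply, smul_sub, hn', sub_self]
    exact add_sub_cancel (T • n) m ▸ Submodule.add_mem_sup ⟨n, rfl⟩ h1
  · intro hm
    obtain ⟨_, ⟨n, rfl⟩, b, hb, rfl⟩ := Submodule.mem_sup.mp hm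
    refine ⟨⟨T • n, n, rfl⟩, Subtype.ext ?_⟩
    change T • T • n = T • (T • n + b)
    have hb' : T • b = 0 := hb
    rw [smul_add, hb', add_zero]

end Duality

/-! ### Multiplication by `T` on cyclic and finitely generated modules. -/

section CyclicModules

variable {p : ℕ} [Fact p.Prime] {A : Type*} [CommRing A] [Algebra ℤ_[p] A]
  (e : A ≃ₐ[ℤ_[p]] ℤ_[p]⟦X⟧) {T : A} (hT : e T = PowerSeries.X)

include hT

theorem prime_of_apply_eq_X : Prime T := by
  rw [← MulEquiv.prime_iff (e : A ≃* ℤ_[p]⟦X⟧)]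
  change Prime (e T)
  rw [hT]
  exact X_prime

theorem dvd_iff_constantCoeff_eq_zero {a : A} : T ∣ a ↔ constantCoeff (e a) = 0 := by
  rw [← X_dvd_iff, ← hT, map_dvd_iff e]

theorem mem_jacobson_of_apply_eq_X : T ∈ Ideal.jacobson (⊥ : Ideal A) := by
  rw [Ideal.mem_jacobson_bot]
  intro y
  rw [← isUnit_map_iff e, isUnit_iff_constantCoeff]
  simp [hT]

/-- If `T ^ 2` divides `g` and `E` surjects onto `A / (g)`, then `E / (TE + E[T])` is infinite. -/
theorem index_sup_eq_zero_of_sq_dvd {E : Type*} [AddCommGroup E] [Module A E] {g : A}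
    (hg : T ^ 2 ∣ g) (π : E →ₗ[A] A ⧸ Ideal.span {g}) (hπ : Function.Surjective π) :
    (LinearMap.range (LinearMap.lsmul A E T) ⊔
      LinearMap.ker (LinearMap.lsmul A E T)).toAddSubgroup.index = 0 := by
  have hTp := prime_of_apply_eq_X e hT
  have := isDomain_of_algEquiv e
  let ε : A →+* ℤ_[p] := (constantCoeff (R := ℤ_[p])).comp (e : A →+* ℤ_[p]⟦X⟧)
  have hε : ∀ a, ε a = 0 ↔ T ∣ a := fun a => (dvd_iff_constantCoeff_eq_zero e hT).symm
  have hTg : T ∣ g := (dvd_pow_self T two_ne_zero).trans hg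
  let ε' : A ⧸ Ideal.span {g} →+* ℤ_[p] := Ideal.Quotient.lift _ ε fun a ha =>
    (hε a).mpr (hTg.trans (Ideal.mem_span_singleton.mp ha))
  -- The constant coefficient is a surjection onto the infinite group `ℤ_p`. It kills `TE`, and also
  -- `E[T]`: from `T² ∣ g ∣ T b` follows `T ∣ b`.
  let θ : E →+ ℤ_[p] := (ε' : A ⧸ Ideal.span {g} →+ ℤ_[p]).comp π.toAddMonoidHom
  have hθ : Function.Surjective θ := by
    refine Function.Surjective.comp (g := ε') (fun c => ?_) hπ
    refine ⟨Ideal.Quotient.mk _ (algebraMap ℤ_[p] A c), ?_⟩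
    change constantCoeff (e (algebraMap ℤ_[p] A c)) = c
    rw [AlgEquiv.commutes]
    simp
  have hle : (LinearMap.range (LinearMap.lsmul A E T) ⊔
      LinearMap.ker (LinearMap.lsmul A E T)).toAddSubgroup ≤ θ.ker := by
    intro x hx
    obtain ⟨_, ⟨y, rfl⟩, z, hz, rfl⟩ := Submodule.mem_sup.mp hx
    obtain ⟨b, hb⟩ := Ideal.Quotient.mk_surjective (π z)
    have h1 : ε' (π (T • y)) = 0 := by
      obtain ⟨c, hc⟩ := Ideal.Quotient.mk_surjective (π y)
      rw [map_smul, ← hc]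
      change ε (T * c) = 0
      exact (hε _).mpr (dvd_mul_right T c)
    have h2 : ε' (π z) = 0 := by
      rw [← hb]
      change ε b = 0
      rw [hε]
      have hz' : T • π z = 0 := by
        rw [← map_smul, show T • z = 0 from hz, map_zero]
      rw [← hb] at hz'
      have h3 : g ∣ T * b := Ideal.mem_span_singleton.mp (Ideal.Quotient.eq_zero_iff_mem.mp hz')
      have h4 := hg.trans h3
      rw [pow_two] at h4
      exact (mul_dvd_mul_iff_left hTp.ne_zero).mp h4
    change ε' (π (T • y + z)) = 0
    rw [map_add, map_add, h1, h2, add_zero]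
  refine Nat.eq_zero_of_zero_dvd ?_
  convert AddSubgroup.index_dvd_of_le hle using 1
  rw [AddSubgroup.index_ker, AddMonoidHom.range_eq_top.mpr hθ, Nat.card_congr
    AddSubgroup.topEquiv.toEquiv, Nat.card_eq_zero_of_infinite]

/-- As `T` is prime and divides `g` at most once, one factor `T` of the multiple is superfluous. -/
theorem dvd_mul_of_dvd_sq_mul {g a : A} (hg : ¬ T ^ 2 ∣ g) (h : g ∣ T ^ 2 * a) : g ∣ T * a := by
  have hTp := prime_of_apply_eq_X e hT
  have := isDomain_of_algEquiv e
  have key : ∀ {h b : A}, ¬ T ∣ h → h ∣ T * b → h ∣ b := by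
    rintro h b hh ⟨c, hc⟩
    obtain ⟨d, rfl⟩ := (hTp.dvd_or_dvd (hc ▸ dvd_mul_right T b : T ∣ h * c)).resolve_left hh
    exact ⟨d, mul_left_cancel₀ hTp.ne_zero (by rw [hc]; ring)⟩
  by_cases hTg : T ∣ g
  · obtain ⟨h', rfl⟩ := hTg
    rw [pow_two, mul_assoc, mul_dvd_mul_iff_left hTp.ne_zero] at h
    refine mul_dvd_mul_left T (key (fun h'' => hg ?_) h)
    rw [pow_two]
    exact mul_dvd_mul_left T h''
  · rw [pow_two, mul_assoc] at h
    exact key hTg h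

theorem smul_eq_zero_of_sq_smul_quotient {g : A} (hg : ¬ T ^ 2 ∣ g) {y : A ⧸ Ideal.span {g}}
    (h : T • T • y = 0) : T • y = 0 := by
  obtain ⟨a, rfl⟩ := Ideal.Quotient.mk_surjective y
  refine Ideal.Quotient.eq_zero_iff_mem.mpr (Ideal.mem_span_singleton.mpr ?_)
  refine dvd_mul_of_dvd_sq_mul e hT hg ?_
  rw [pow_two, mul_assoc]
  exact Ideal.mem_span_singleton.mp (Ideal.Quotient.eq_zero_iff_mem.mp h)

/-- On a finitely generated module, `T` is surjective on `TE` only if `TE = 0`. -/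
theorem index_range_smul_range_eq_one_iff {E : Type*} [AddCommGroup E] [Module A E]
    [Module.Finite A E] :
    (LinearMap.lsmul A (LinearMap.range (LinearMap.lsmul A E T)) T).toAddMonoidHom.range.index = 1 ↔
      ∀ y : E, T • y = 0 := by
  have := isNoetherianRing_of_algEquiv e
  rw [AddSubgroup.index_eq_one, AddMonoidHom.range_eq_top]
  constructor
  · intro h
    set N := LinearMap.range (LinearMap.lsmul A E T) with hN
    have hle : N ≤ Ideal.span {T} • N := by
      intro x hx
      obtain ⟨y, hy⟩ := h ⟨x, hx⟩
      have hy' : T • (y : E) = x := congrArg Subtype.val hy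
      rw [← hy']
      exact Submodule.smul_mem_smul (Ideal.mem_span_singleton_self T) y.2
    -- Nakayama's lemma, as `T` lies in the Jacobson radical.
    have hbot := Submodule.eq_bot_of_le_smul_of_le_jacobson_bot (Ideal.span {T}) N
      (IsNoetherian.noetherian N) hle
      ((Ideal.span_singleton_le_iff_mem _).mpr (mem_jacobson_of_apply_eq_X e hT))
    intro y
    have : T • y ∈ N := ⟨y, rfl⟩
    rwa [hbot] at this
  · rintro h ⟨_, y, rfl⟩
    exact ⟨0, Subtype.ext (by simpa using (h y).symm)⟩

end CyclicModules

/-! ### Distinguished polynomials dividing `X`, and the invariants of elementary data. -/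

section Polynomials

variable {p : ℕ} [Fact p.Prime]

theorem rootMultiplicity_le_natDegree (f : ℤ_[p][X]) (a : ℤ_[p]) :
    f.rootMultiplicity a ≤ f.natDegree := by
  classical
  rw [← Polynomial.count_roots]
  exact (Multiset.count_le_card _ _).trans f.card_roots'

/-- Compare coefficients `0` and `1` in `f c = X`. In degree at least two both low coefficients of
`f` are divisible by `p`, and `1 = f₀c₁ + f₁c₀` is impossible. In degree one the same equation
excludes `c₀ = 0`, so `f₀ = 0`. -/
theorem natDegree_eq_rootMultiplicity_of_dvd_X {f : ℤ_[p][X]}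
    (hf : f.IsDistinguishedAt (Ideal.span {(p : ℤ_[p])})) (h : (f : ℤ_[p]⟦X⟧) ∣ X) :
    f.natDegree = f.rootMultiplicity 0 := by
  obtain ⟨c, hc⟩ := h
  have h0 := congrArg (coeff 0) hc
  have h1 := congrArg (coeff 1) hc
  rw [coeff_mul, Finset.Nat.antidiagonal_zero, Finset.sum_singleton, Polynomial.coeff_coe,
    coeff_zero_X] at h0
  rw [coeff_mul, coeff_one_X, Finset.Nat.antidiagonal_succ] at h1
  simp only [Finset.Nat.antidiagonal_zero, Finset.map_singleton, Finset.sum_cons,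
    Finset.sum_singleton, Polynomial.coeff_coe] at h1
  change (1 : ℤ_[p]) = f.coeff 0 * coeff 1 c + f.coeff 1 * coeff 0 c at h1
  have hp : Ideal.span {(p : ℤ_[p])} ≠ ⊤ := by
    rw [← PadicInt.maximalIdeal_eq_span_p]
    exact Ideal.IsPrime.ne_top'
  have hone : ∀ a b : ℤ_[p], f.coeff 0 ∈ Ideal.span {(p : ℤ_[p])} →
      1 ≠ f.coeff 0 * a + p * b := fun a b h h' =>
    hp ((Ideal.eq_top_iff_one _).mpr (h' ▸ add_mem (Ideal.mul_mem_right _ _ h)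
      (Ideal.mul_mem_right _ _ (Ideal.mem_span_singleton_self _))))
  refine le_antisymm ?_ (rootMultiplicity_le_natDegree f 0)
  rcases Nat.lt_or_ge f.natDegree 1 with hd | hd
  · omega
  have hf0 := hf.mem hd
  rcases Nat.lt_or_ge f.natDegree 2 with hd' | hd'
  · have hd1 : f.natDegree = 1 := by omega
    rw [hd1, Nat.one_le_iff_ne_zero, ← Nat.pos_iff_ne_zero,
      Polynomial.rootMultiplicity_pos hf.monic.ne_zero, Polynomial.IsRoot.def,
      ← Polynomial.coeff_zero_eq_eval_zero]
    refine (mul_eq_zero.mp h0.symm).resolve_right fun hc0 => hone (coeff 1 c) 0 hf0 ?_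
    rw [h1, hc0, mul_zero, mul_zero]
  · obtain ⟨b, hb⟩ := Ideal.mem_span_singleton.mp (hf.mem (lt_of_lt_of_le one_lt_two hd'))
    exact absurd (h1.trans (by rw [hb, mul_assoc])) (hone _ _ hf0)

theorem dvd_X_of_natDegree_eq_rootMultiplicity {f : ℤ_[p][X]} (hf : f.Monic)
    (h2 : ¬ (X : ℤ_[p]⟦X⟧) ^ 2 ∣ f) (h : f.natDegree = f.rootMultiplicity 0) :
    (f : ℤ_[p]⟦X⟧) ∣ X := by
  have hd := Polynomial.pow_rootMultiplicity_dvd f 0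
  rw [← h, map_zero, sub_zero] at hd
  have hfX : f = Polynomial.X ^ f.natDegree :=
    Polynomial.eq_of_monic_of_dvd_of_natDegree_le (Polynomial.monic_X_pow _) hf hd (by simp)
  have hlt : f.natDegree ≤ 1 := by
    by_contra! h3
    refine h2 ?_
    rw [hfX, Polynomial.coe_pow, Polynomial.coe_X]
    exact pow_dvd_pow _ h3
  rw [hfX, Polynomial.coe_pow, Polynomial.coe_X]
  exact (pow_dvd_pow _ hlt).trans (by rw [pow_one])

theorem natDegree_charPoly (D : ElementaryData p) :
    D.charPoly.natDegree = ∑ i, (D.f i).natDegree := by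
  rw [ElementaryData.charPoly, Polynomial.natDegree_C_mul
    (pow_ne_zero _ (Nat.cast_ne_zero.mpr (NeZero.ne p))),
    Polynomial.natDegree_prod_of_monic _ _ fun i _ => (D.distinguished i).monic]

theorem rootMultiplicity_charPoly (D : ElementaryData p) :
    D.charPoly.rootMultiplicity 0 = ∑ i, (D.f i).rootMultiplicity 0 := by
  have hprod : ∀ s : Finset (Fin D.n), (∏ i ∈ s, D.f i).rootMultiplicity 0 =
      ∑ i ∈ s, (D.f i).rootMultiplicity 0 := by
    intro s
    classical
    induction s using Finset.induction_on with
    | empty => simp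
    | insert i s hi ih =>
      rw [Finset.prod_insert hi, Finset.sum_insert hi, Polynomial.rootMultiplicity_mul, ih]
      exact mul_ne_zero (D.distinguished i).monic.ne_zero
        (Polynomial.monic_prod_of_monic _ _ fun i _ => (D.distinguished i).monic).ne_zero
  rw [ElementaryData.charPoly, Polynomial.rootMultiplicity_mul, Polynomial.rootMultiplicity_C,
    zero_add, hprod]
  exact mul_ne_zero (Polynomial.C_ne_zero.mpr
    (pow_ne_zero _ (Nat.cast_ne_zero.mpr (NeZero.ne p))))
    (Polynomial.monic_prod_of_monic _ _ fun i _ => (D.distinguished i).monic).ne_zero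

/-- Each root multiplicity is at most the degree, so the sums agree only if all terms do. -/
theorem natDegree_charPoly_eq_rootMultiplicity_iff (D : ElementaryData p) :
    D.charPoly.natDegree = D.charPoly.rootMultiplicity 0 ↔
      ∀ i, (D.f i).natDegree = (D.f i).rootMultiplicity 0 := by
  rw [natDegree_charPoly, rootMultiplicity_charPoly, eq_comm,
    Finset.sum_eq_sum_iff_of_le fun i _ => rootMultiplicity_le_natDegree (D.f i) 0]
  simp only [Finset.mem_univ, true_implies, eq_comm]

end Polynomials

/-! ### The Herbrand quotient of `T` on `TX`, read off the elementary module. -/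

section PseudoIsomorphism

variable {p : ℕ} [Fact p.Prime] {A : Type*} [CommRing A] [Algebra ℤ_[p] A]
  (e : A ≃ₐ[ℤ_[p]] ℤ_[p]⟦X⟧) {T : A} (hT : e T = PowerSeries.X)

include hT

theorem aeval_dvd_iff {f g : ℤ_[p][X]} :
    Polynomial.aeval T f ∣ Polynomial.aeval T g ↔ (f : ℤ_[p]⟦X⟧) ∣ g := by
  rw [← map_dvd_iff e, apply_aeval e hT, apply_aeval e hT]

theorem not_sq_dvd_natCast_pow (k : ℕ) : ¬ T ^ 2 ∣ (p : A) ^ k := by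
  intro h
  have h1 := (prime_of_apply_eq_X e hT).dvd_of_dvd_pow ((dvd_pow_self T two_ne_zero).trans h)
  rw [dvd_iff_constantCoeff_eq_zero e hT, map_natCast, map_natCast] at h1
  exact NeZero.ne p (Nat.cast_eq_zero.mp h1)

theorem natCast_pow_dvd_iff (k : ℕ) : (p : A) ^ k ∣ T ↔ k = 0 := by
  constructor
  · intro h
    by_contra hk
    obtain ⟨c, hc⟩ := (dvd_pow_self (p : A) hk).trans h
    have h1 := congrArg (fun a => coeff 1 (e a)) hc
    simp only [hT, map_mul, map_natCast, coeff_one_X] at h1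
    rw [← map_natCast (C (R := ℤ_[p])) p, coeff_C_mul] at h1
    exact PadicInt.prime_p.not_isUnit (isUnit_of_dvd_one ⟨_, h1⟩)
  · rintro rfl
    exact pow_zero (p : A) ▸ one_dvd T

omit hT in
theorem smul_quotient_eq_zero_iff {g a : A} :
    (∀ y : A ⧸ Ideal.span {g}, a • y = 0) ↔ g ∣ a := by
  constructor
  · intro h
    have := h (Ideal.Quotient.mk _ 1)
    have h2 : Ideal.Quotient.mk (Ideal.span {g}) (a * 1) = 0 := this
    rwa [Ideal.Quotient.eq_zero_iff_mem, Ideal.mem_span_singleton, mul_one] at h2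
  · intro h y
    obtain ⟨z, rfl⟩ := Ideal.Quotient.mk_surjective y
    exact Ideal.Quotient.eq_zero_iff_mem.mpr
      (Ideal.mem_span_singleton.mpr (h.trans (dvd_mul_right a z)))

theorem card_ker_eq_index_iff_of_pseudoIsomorphism {X : Type*} [AddCommGroup X] [Module A X]
    (D : ElementaryData p)
    (ψ : X →ₗ[A] ((i : Fin D.n) → A ⧸ Ideal.span {Polynomial.aeval T (D.f i)}) ×
        ((j : Fin D.m) → A ⧸ Ideal.span {(p : A) ^ D.exponent j}))
    (hψ : Finite (LinearMap.ker ψ))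
    (hψ' : Finite ((((i : Fin D.n) → A ⧸ Ideal.span {Polynomial.aeval T (D.f i)}) ×
        ((j : Fin D.m) → A ⧸ Ideal.span {(p : A) ^ D.exponent j})) ⧸ LinearMap.range ψ))
    (hker : Finite (LinearMap.lsmul A (LinearMap.range (LinearMap.lsmul A X T)) T).toAddMonoidHom.ker)
    (hindex : (LinearMap.lsmul A
      (LinearMap.range (LinearMap.lsmul A X T)) T).toAddMonoidHom.range.index ≠ 0) :
    Nat.card (LinearMap.lsmul A (LinearMap.range (LinearMap.lsmul A X T)) T).toAddMonoidHom.ker =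
      (LinearMap.lsmul A (LinearMap.range (LinearMap.lsmul A X T)) T).toAddMonoidHom.range.index ↔
    D.mu = 0 ∧ D.charPoly.natDegree = D.charPoly.rootMultiplicity 0 := by
  set E := ((i : Fin D.n) → A ⧸ Ideal.span {Polynomial.aeval T (D.f i)}) ×
        ((j : Fin D.m) → A ⧸ Ideal.span {(p : A) ^ D.exponent j})
  set N := LinearMap.range (LinearMap.lsmul A X T)
  set N' := LinearMap.range (LinearMap.lsmul A E T) with hN'
  have hmaps : ∀ x ∈ N, ψ x ∈ N' := by
    rintro _ ⟨x, rfl⟩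
    exact ⟨ψ x, (map_smul ψ T x).symm⟩
  let φ : N →ₗ[A] N' := ψ.restrict hmaps
  have hcomm : (LinearMap.lsmul A N' T).toAddMonoidHom.comp φ.toAddMonoidHom =
      φ.toAddMonoidHom.comp (LinearMap.lsmul A N T).toAddMonoidHom :=
    AddMonoidHom.ext fun x => (map_smul φ T x).symm
  have hφ : Finite φ.toAddMonoidHom.ker := by
    refine Finite.of_injective (β := LinearMap.ker ψ)
      (fun x => ⟨x.1.1, congrArg Subtype.val x.2⟩) fun x y h => ?_
    exact Subtype.ext (Subtype.ext (congrArg (fun z : LinearMap.ker ψ => (z : X)) h))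
  -- Pulled back along `T : E → TE`, the image of `TX` contains the image of `ψ`, which has finite
  -- index.
  have hφ' : φ.toAddMonoidHom.range.index ≠ 0 := by
    have hs := LinearMap.surjective_rangeRestrict (LinearMap.lsmul A E T)
    rw [← AddSubgroup.index_comap_of_surjective _
      (f := (LinearMap.lsmul A E T).rangeRestrict.toAddMonoidHom) hs]
    have hle : (LinearMap.range ψ).toAddSubgroup ≤ AddSubgroup.comap
        (LinearMap.lsmul A E T).rangeRestrict.toAddMonoidHom φ.toAddMonoidHom.range := by
      rintro _ ⟨x, rfl⟩
      exact ⟨⟨T • x, x, rfl⟩, Subtype.ext (map_smul ψ T x)⟩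
    refine ne_zero_of_dvd_ne_zero ?_ (AddSubgroup.index_dvd_of_le hle)
    exact (Nat.card_pos (α := E ⧸ LinearMap.range ψ)).ne'
  have hindex' := index_range_ne_zero_of_comm hcomm hφ' hindex
  have hindexE := hindex'
  rw [index_range_smul_range] at hindexE
  -- This is where finiteness of the truncated Euler characteristic enters: a double zero of some
  -- `f_i` at `0` would make `E/(TE + E[T])` infinite.
  have hsq : ∀ i, ¬ T ^ 2 ∣ Polynomial.aeval T (D.f i) := fun i h =>
    hindexE (index_sup_eq_zero_of_sq_dvd e hT h
      (LinearMap.proj i ∘ₗ LinearMap.fst A _ _)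
      ((Function.surjective_eval i).comp Prod.fst_surjective))
  have hinj : ∀ y : E, T • T • y = 0 → T • y = 0 := by
    intro y hy
    refine Prod.ext (funext fun i => ?_) (funext fun j => ?_)
    · exact smul_eq_zero_of_sq_smul_quotient e hT (hsq i) (congrFun (congrArg Prod.fst hy) i)
    · exact smul_eq_zero_of_sq_smul_quotient e hT (not_sq_dvd_natCast_pow e hT _)
        (congrFun (congrArg Prod.snd hy) j)
  have hkerbot : (LinearMap.lsmul A N' T).toAddMonoidHom.ker = ⊥ := by
    rw [eq_bot_iff]
    rintro ⟨_, y, rfl⟩ h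
    exact Subtype.ext (hinj y (congrArg Subtype.val h))
  have hfinker : Finite (LinearMap.lsmul A N' T).toAddMonoidHom.ker := by
    rw [hkerbot]
    infer_instance
  -- With trivial kernel on `TE`, Herbrand quotient one means cokernel of order one, that is `TE =
  -- 0`.
  rw [card_ker_eq_index_range_iff_of_comm hcomm hφ hφ' hker hindex hfinker, hkerbot,
    AddSubgroup.card_bot, eq_comm, index_range_smul_range_eq_one_iff e hT,
    natDegree_charPoly_eq_rootMultiplicity_iff]
  have hf : ∀ i, Polynomial.aeval T (D.f i) ∣ T ↔
      (D.f i).natDegree = (D.f i).rootMultiplicity 0 := by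
    intro i
    have h1 := aeval_dvd_iff e hT (f := D.f i) (g := Polynomial.X)
    have h2 := aeval_dvd_iff e hT (g := D.f i) (f := Polynomial.X ^ 2)
    rw [Polynomial.aeval_X, Polynomial.coe_X] at h1
    rw [map_pow, Polynomial.aeval_X, Polynomial.coe_pow, Polynomial.coe_X] at h2
    rw [h1]
    exact ⟨natDegree_eq_rootMultiplicity_of_dvd_X (D.distinguished i),
      dvd_X_of_natDegree_eq_rootMultiplicity (D.distinguished i).monic (h2.not.mp (hsq i))⟩
  have hmu : D.mu = 0 ↔ ∀ j, (p : A) ^ D.exponent j ∣ T := by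
    simp only [natCast_pow_dvd_iff e hT, ElementaryData.mu, Finset.sum_eq_zero_iff,
      Finset.mem_univ, true_implies]
  rw [hmu]
  simp only [← hf, ← smul_quotient_eq_zero_iff (A := A)]
  classical
  constructor
  · intro h
    refine ⟨fun j y => ?_, fun i y => ?_⟩
    · have := congrFun (congrArg Prod.snd (h (0, Pi.single j y))) j
      change T • (Pi.single j y : (j : Fin D.m) → A ⧸ Ideal.span {(p : A) ^ D.exponent j}) j = 0 at this
      rwa [Pi.single_eq_same] at this
    · have := congrFun (congrArg Prod.fst (h (Pi.single i y, 0))) i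
      change T • (Pi.single i y :
        (i : Fin D.n) → A ⧸ Ideal.span {Polynomial.aeval T (D.f i)}) i = 0 at this
      rwa [Pi.single_eq_same] at this
  · rintro ⟨h1, h2⟩ y
    exact Prod.ext (funext fun i => h2 i _) (funext fun j => h1 j _)

end PseudoIsomorphism

/-! ### Invariants and coinvariants in terms of `T = γ - 1`. -/

section GammaAction

variable {p : ℕ} [Fact p.Prime] {Γ : Type*} [CommGroup Γ] [TopologicalSpace Γ]
  [IsTopologicalGroup Γ] {γ : Γ} (hγ : (Subgroup.zpowers γ).topologicalClosure = ⊤)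
  {M : Type*} [AddCommGroup M] [Module (IwasawaAlgebra p Γ) M]

include hγ in
-- The elements acting on `m` as `g` does form an open set, which meets the dense subgroup generated
-- by `γ`.
theorem exists_zpow_gammaAction_eq (hdisc : IsDiscretePrimary p Γ M) (g : Γ) (m : M) :
    ∃ n : ℤ, gammaAction p Γ M g m = gammaAction p Γ M (γ ^ n) m := by
  have hd : Dense (Subgroup.zpowers γ : Set Γ) := by
    intro y
    rw [← Subgroup.topologicalClosure_coe, hγ]
    trivial
  obtain ⟨y, hy, n, rfl⟩ := hd.inter_open_nonempty _
    ((hdisc.2 m).preimage (continuous_const_mul g⁻¹)) ⟨g, by simp⟩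
  refine ⟨n, ?_⟩
  have h : gammaAction p Γ M (g⁻¹ * γ ^ n) m = m := hy
  calc gammaAction p Γ M g m = gammaAction p Γ M g (gammaAction p Γ M (g⁻¹ * γ ^ n) m) := by rw [h]
    _ = gammaAction p Γ M (γ ^ n) m := by
      rw [← Module.End.mul_apply, ← map_mul, mul_inv_cancel_left]

omit [IsTopologicalGroup Γ] in
theorem gammaAction_sub_self (γ : Γ) (m : M) :
    gammaAction p Γ M γ m - m = (groupElement p γ - 1) • m := by
  rw [sub_smul, one_smul]
  rfl

include hγ in
theorem mem_invariants_iff (hdisc : IsDiscretePrimary p Γ M) (m : M) :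
    m ∈ (gammaAction p Γ M).invariants ↔
      m ∈ LinearMap.ker (LinearMap.lsmul (IwasawaAlgebra p Γ) M (groupElement p γ - 1)) := by
  rw [Representation.mem_invariants, LinearMap.mem_ker, LinearMap.lsmul_apply,
    ← gammaAction_sub_self, sub_eq_zero]
  refine ⟨fun h => h γ, fun h g => ?_⟩
  obtain ⟨n, hn⟩ := exists_zpow_gammaAction_eq hγ hdisc g m
  let S : Subgroup Γ :=
    { carrier := {g | gammaAction p Γ M g m = m}
      one_mem' := by simp
      mul_mem' := fun {a b} ha hb => by
        change gammaAction p Γ M (a * b) m = m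
        rw [map_mul, Module.End.mul_apply, show gammaAction p Γ M b m = m from hb]
        exact ha
      inv_mem' := fun {a} ha => by
        change gammaAction p Γ M a⁻¹ m = m
        nth_rw 1 [← show gammaAction p Γ M a m = m from ha]
        rw [← Module.End.mul_apply, ← map_mul, inv_mul_cancel, map_one, Module.End.one_apply] }
  rw [hn]
  exact S.zpow_mem (x := γ) h n

include hγ in
theorem mem_coinvariants_ker_iff (hdisc : IsDiscretePrimary p Γ M) (m : M) :
    m ∈ Representation.Coinvariants.ker (gammaAction p Γ M) ↔
      m ∈ LinearMap.range (LinearMap.lsmul (IwasawaAlgebra p Γ) M (groupElement p γ - 1)) := by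
  set N := LinearMap.range (LinearMap.lsmul (IwasawaAlgebra p Γ) M (groupElement p γ - 1))
  let S : Subgroup Γ :=
    { carrier := {g | ∀ m, gammaAction p Γ M g m - m ∈ N}
      one_mem' := fun m => by simp
      mul_mem' := fun {a b} ha hb m => by
        have h := add_mem (ha (gammaAction p Γ M b m)) (hb m)
        rwa [sub_add_sub_cancel, ← Module.End.mul_apply, ← map_mul] at h
      inv_mem' := fun {a} ha m => by
        have h := neg_mem (ha (gammaAction p Γ M a⁻¹ m))
        rwa [neg_sub, ← Module.End.mul_apply, ← map_mul, mul_inv_cancel, map_one,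
          Module.End.one_apply] at h }
  have hγS : γ ∈ S := fun m => ⟨m, (gammaAction_sub_self γ m).symm⟩
  constructor
  · intro h
    have hle : Representation.Coinvariants.ker (gammaAction p Γ M) ≤ N.toAddSubgroup.toIntSubmodule := by
      refine Submodule.span_le.mpr ?_
      rintro _ ⟨⟨g, x⟩, rfl⟩
      obtain ⟨n, hn⟩ := exists_zpow_gammaAction_eq hγ hdisc g x
      change gammaAction p Γ M g x - x ∈ N
      rw [hn]
      exact S.zpow_mem hγS n x
    exact hle h
  · rintro ⟨x, rfl⟩
    rw [LinearMap.lsmul_apply, ← gammaAction_sub_self]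
    exact Representation.Coinvariants.sub_mem_ker γ x

include hγ in
theorem nonempty_ker_phi_equiv (hdisc : IsDiscretePrimary p Γ M) :
    Nonempty (LinearMap.ker (phi p Γ M) ≃
      (LinearMap.ker (LinearMap.lsmul (IwasawaAlgebra p Γ) M (groupElement p γ - 1)) ⊓
        LinearMap.range (LinearMap.lsmul (IwasawaAlgebra p Γ) M (groupElement p γ - 1)) :
          Submodule (IwasawaAlgebra p Γ) M)) := by
  have h : ∀ x : (gammaAction p Γ M).invariants, x ∈ LinearMap.ker (phi p Γ M) ↔ (x : M) ∈
      LinearMap.range (LinearMap.lsmul (IwasawaAlgebra p Γ) M (groupElement p γ - 1)) := by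
    intro x
    rw [← mem_coinvariants_ker_iff hγ hdisc]
    exact Submodule.Quotient.mk_eq_zero _
  exact ⟨⟨fun x => ⟨x.1.1, (mem_invariants_iff hγ hdisc _).mp x.1.2, (h x.1).mp x.2⟩,
    fun x => ⟨⟨x.1, (mem_invariants_iff hγ hdisc _).mpr x.2.1⟩, (h _).mpr x.2.2⟩,
    fun x => rfl, fun x => rfl⟩⟩

include hγ in
theorem nonempty_coker_phi_equiv (hdisc : IsDiscretePrimary p Γ M) :
    Nonempty (((gammaAction p Γ M).Coinvariants ⧸ LinearMap.range (phi p Γ M)) ≃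
      (M ⧸ (LinearMap.range (LinearMap.lsmul (IwasawaAlgebra p Γ) M (groupElement p γ - 1)) ⊔
        LinearMap.ker (LinearMap.lsmul (IwasawaAlgebra p Γ) M (groupElement p γ - 1))))) := by
  set V := LinearMap.range (LinearMap.lsmul (IwasawaAlgebra p Γ) M (groupElement p γ - 1)) ⊔
        LinearMap.ker (LinearMap.lsmul (IwasawaAlgebra p Γ) M (groupElement p γ - 1))
  let π : M →+ (gammaAction p Γ M).Coinvariants ⧸ LinearMap.range (phi p Γ M) :=
    ((LinearMap.range (phi p Γ M)).mkQ ∘ₗ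
      Representation.Coinvariants.mk (gammaAction p Γ M)).toAddMonoidHom
  have hπ : Function.Surjective π :=
    (Submodule.mkQ_surjective _).comp (Submodule.mkQ_surjective _)
  have hker : π.ker = V.toAddSubgroup := by
    ext m
    constructor
    · intro hm
      obtain ⟨x, hx⟩ := (Submodule.Quotient.mk_eq_zero _).mp hm
      have h1 : m - x.1 ∈ Representation.Coinvariants.ker (gammaAction p Γ M) :=
        (Submodule.Quotient.eq _).mp hx.symm
      have h2 := Submodule.add_mem_sup ((mem_coinvariants_ker_iff hγ hdisc _).mp h1)
        ((mem_invariants_iff hγ hdisc _).mp x.2)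
      rwa [sub_add_cancel] at h2
    · intro hm
      obtain ⟨a, ha, b, hb, rfl⟩ := Submodule.mem_sup.mp hm
      refine (Submodule.Quotient.mk_eq_zero _).mpr
        ⟨⟨b, (mem_invariants_iff hγ hdisc _).mpr hb⟩, ?_⟩
      refine ((Submodule.Quotient.eq _).mpr ?_).symm
      rw [Submodule.subtype_apply, add_sub_cancel_right]
      exact (mem_coinvariants_ker_iff hγ hdisc _).mpr ha
  exact ⟨((QuotientAddGroup.quotientKerEquivOfSurjective π hπ).symm.trans
    (QuotientAddGroup.quotientAddEquivOfEq hker)).toEquiv⟩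

end GammaAction

/-! ### The truncated Euler characteristic. -/

theorem truncatedEulerChar_eq_one_iff (p : ℕ) [Fact p.Prime]
    (Γ : Type*) [CommGroup Γ] [TopologicalSpace Γ] [IsTopologicalGroup Γ]
    (hΓ : Nonempty (Γ ≃ₜ* Multiplicative ℤ_[p]))
    (γ : Γ) (hγ : (Subgroup.zpowers γ).topologicalClosure = ⊤)
    (M : Type*) [AddCommGroup M] [Module (IwasawaAlgebra p Γ) M]
    (hdisc : IsDiscretePrimary p Γ M)
    (hfg : IsCofinitelyGenerated p Γ M)
    (htors : IsCotorsion p Γ M)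
    (hfin : HasFiniteTruncatedEulerChar p Γ M) :
    truncatedEulerChar p Γ M = 1 ↔
      muInvariant p γ M = 0 ∧
        lambdaInvariant p γ M = rInvariant p γ M := by
  obtain ⟨e, hT⟩ := exists_algEquiv_powerSeries hΓ hγ
  have : Module.Finite (IwasawaAlgebra p Γ) (CharacterModule M) := hfg
  -- The structure theorem guarantees that the chosen data is not a junk value; nothing else about
  -- the choice is used.
  have hD : IsStructureOf p γ (CharacterModule M) (structureData p γ M) :=
    Classical.epsilon_spec (p := fun D => IsStructureOf p γ (CharacterModule M) D)
      (exists_elementary_pseudoIsomorphism e hT htors)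
  obtain ⟨ψ, hψ, hψ'⟩ := hD
  obtain ⟨E₁⟩ := nonempty_ker_phi_equiv hγ hdisc
  obtain ⟨E₂⟩ := nonempty_coker_phi_equiv hγ hdisc
  have := hfin.1
  have := hfin.2
  have := Finite.of_equiv _ E₁
  have := Finite.of_equiv _ E₂
  set T : IwasawaAlgebra p Γ := groupElement p γ - 1 with hTdef
  -- Duality exchanges the roles: the kernel of `φ_M` gives the cokernel of `T` on `TX`, and the
  -- cokernel of `φ_M` gives its kernel.
  have h₁ : Nat.card (LinearMap.ker (phi p Γ M)) = (LinearMap.lsmul (IwasawaAlgebra p Γ)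
      (LinearMap.range (LinearMap.lsmul (IwasawaAlgebra p Γ) (CharacterModule M) T)) T).toAddMonoidHom.range.index := by
    rw [Nat.card_congr E₁, ← card_characterModule, card_characterModule_ker_inf_range,
      index_range_smul_range]
  have h₂ : Nat.card ((gammaAction p Γ M).Coinvariants ⧸ LinearMap.range (phi p Γ M)) =
      Nat.card (LinearMap.lsmul (IwasawaAlgebra p Γ)
      (LinearMap.range (LinearMap.lsmul (IwasawaAlgebra p Γ) (CharacterModule M) T)) T).toAddMonoidHom.ker := by
    rw [Nat.card_congr E₂, ← card_characterModule, card_characterModule_quotient,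
      card_ker_smul_range]
  have hne₁ : Nat.card (LinearMap.ker (phi p Γ M)) ≠ 0 := Nat.card_pos.ne'
  have hne₂ : Nat.card ((gammaAction p Γ M).Coinvariants ⧸ LinearMap.range (phi p Γ M)) ≠ 0 :=
    Nat.card_pos.ne'
  have key := card_ker_eq_index_iff_of_pseudoIsomorphism e hT (structureData p γ M) ψ hψ hψ'
    (Nat.finite_of_card_ne_zero (h₂ ▸ hne₂)) (h₁ ▸ hne₁)
  rw [← h₁, ← h₂] at key
  refine Iff.trans ?_ key
  rw [truncatedEulerChar, div_eq_one_iff_eq (Nat.cast_ne_zero.mpr hne₂), Nat.cast_inj, eq_comm]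


end TruncatedEuler

end

theorem mainTheorem10 (p : ℕ) [Fact p.Prime]
    (Γ : Type*) [CommGroup Γ] [TopologicalSpace Γ] [IsTopologicalGroup Γ]
    (hΓ : Nonempty (Γ ≃ₜ* Multiplicative ℤ_[p]))
    (γ : Γ) (hγ : (Subgroup.zpowers γ).topologicalClosure = ⊤)
    (M : Type*) [AddCommGroup M] [Module (TruncatedEuler.IwasawaAlgebra p Γ) M]
    (hdisc : TruncatedEuler.IsDiscretePrimary p Γ M)
    (hfg : TruncatedEuler.IsCofinitelyGenerated p Γ M)
    (htors : TruncatedEuler.IsCotorsion p Γ M)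
    (hfin : TruncatedEuler.HasFiniteTruncatedEulerChar p Γ M) :
    TruncatedEuler.truncatedEulerChar p Γ M = 1 ↔
      TruncatedEuler.muInvariant p γ M = 0 ∧
        TruncatedEuler.lambdaInvariant p γ M = TruncatedEuler.rInvariant p γ M :=
  TruncatedEuler.truncatedEulerChar_eq_one_iff p Γ hΓ γ hγ M hdisc hfg htors hfin
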